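/- Let $U\subset\mathbb R^3$ be open and let $B:U\to\mathbb R^3$ be a $C^2$ vector field without zeros and with $\operatorname{div}B=0$. Put $b=B/|B|$, $c=\operatorname{curl}b$, $\beta(v,w)=B\cdot(v\times w)$, and let $'$ denote $b\cdot\nabla$. Let $\Sigma^-=\{|B|'=0,\ |B|''<0\}$, a surface with tangent planes $T_x\Sigma^-=\ker d(|B|')_x$, and $\Sigma^0=\{|B|'=0,\ |B|''=0\}$, both in $U$; put $h=|B|$ on $\Sigma^-\cup\Sigma^0$. For a direction $\sigma=\pm1$ and $x\in\Sigma^-$, the segment from $x$ is the piece of fieldline in $U$ that starts at $x$, goes in the direction $\sigma b$, and ends at the first point where $|B|=h(x)$ again, with $|B|<h(x)$ in between. Let $s\in[0,\ell]$ be the arclength from $x$ along it, let $|u|=\sqrt{2(h(x)-|B|)}$, and let $ȷ(x)=\int_0^\ell|u|\,ds$. Let ${\Sigma^-}'$ be the set of $x\in\Sigma^-$ whose segment exists and is not heteroclinic, i.e. $|B|'\neq0$ at its far end. Along the segment $\gamma$ of $x\in{\Sigma^-}'$ let $a(s)$ be the covector solving $da_i/ds=-\sigma a_j\,\partial_i b^j$,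 $a(0)=d|B|(x)$ (the derivative of the fieldline label $h$), and put $$M_h(x)=\int_0^\ell \frac{a\cdot\operatorname{curl}(|u|\,b)}{|B|}\,ds ,$$ where $h(x)$ is held constant in the curl. For $\varepsilon=\sqrt{\tilde\mu}$ the scaled guiding-centre motion has $dX/d\tau=V_\varepsilon(X,u)=\dfrac{u\tilde B+\varepsilon\, b\times\nabla|B|}{\tilde B\cdot b}$ with $\tilde B=B+\varepsilon u\,c$, and Hamiltonian $\tilde H=\tfrac12u^2+|B|$. Let $D(X,u)=\partial_\varepsilon V_\varepsilon(X,u)|_{\varepsilon=0}$. The first-order change of the label $h$ from $x$ to the first bounce, along the backward ($\eta=1$) or forward ($\eta=-1$) contracting manifold, is $$\Delta^{\eta}(x)=\int_0^\ell\frac{a(s)\,D(\gamma(s),\eta\sigma|u|)-a(0)\,D(x,0)}{\eta\,|u|}\,ds ,$$ and the first-order splitting is $\Delta^{+1}-\Delta^{-1}$. Theorem. For each direction $\sigma$ and each $x\in{\Sigma^-}'$: 1. the covector $a$ exists, the integrals $M_h(x)$ and $\Delta^{\pm1}(x)$ converge, and $M_h$ measures the first-order splitting: $\Delta^{+1}(x)-\Delta^{-1}(x)=2M_h(x)$;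 2. $ȷ$ is differentiable along $\Sigma^-$ at $x$, and on $T_x\Sigma^-$ $$dh\wedge dȷ=M_h\,\beta;$$ 3. the first-order splitting vanishes at $x$ if and only if $dh$ and $dȷ$ are linearly dependent on $T_x\Sigma^-$. Consequently strong isodrasticity to first order in $\sqrt{\tilde\mu}$ (for both directions the first-order splitting vanishes on ${\Sigma^-}'$, and $\tilde H$ is constant on the connected components of $\Sigma^0\times\{0\}$) is equivalent to the weak isodrasticity condition (for both directions $dh$ and $dȷ$ are linearly dependent on ${\Sigma^-}'$, and $h$ is constant on the connected components of $\Sigma^0$). -/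

import Mathlib

open MeasureTheory Set

noncomputable section

namespace GuidingCentre

/-- Physical space, with its Euclidean structure. -/
abbrev Space := EuclideanSpace ℝ (Fin 3)

/-! ### Vector calculus in physical space -/

/-- The cross product. -/
def cross (v w : Space) : Space :=
  WithLp.toLp 2 (crossProduct (WithLp.ofLp v) (WithLp.ofLp w))

/-- The partial derivative `∂ᵢ Fⱼ` at `x`. -/
def partialD (F : Space → Space) (i j : Fin 3) (x : Space) : ℝ :=
  fderiv ℝ F x (EuclideanSpace.single i (1 : ℝ)) j

/-- The divergence of a vector field. -/
def divergence (F : Space → Space) (x : Space) : ℝ :=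
  ∑ i : Fin 3, partialD F i i x

/-- The curl of a vector field. -/
def curl (F : Space → Space) (x : Space) : Space :=
  !₂[partialD F 1 2 x - partialD F 2 1 x,
     partialD F 2 0 x - partialD F 0 2 x,
     partialD F 0 1 x - partialD F 1 0 x]

/-- The exterior product of two covectors, evaluated on two vectors. -/
def wedge (p q : Space →L[ℝ] ℝ) (v w : Space) : ℝ :=
  p v * q w - p w * q v

/-! ### The magnetic field and the critical points of its strength along fieldlines -/

/-- The magnetic flux 2-form `β = i_B Ω`: `β(v, w) = Ω(B, v, w) = B · (v × w)`. -/
def fluxForm (B : Space → Space) (x v w : Space) : ℝ :=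
  inner ℝ (B x) (cross v w)

/-- The field strength `|B|`. -/
def fieldStrength (B : Space → Space) (x : Space) : ℝ := ‖B x‖

/-- The unit field `b = B / |B|`. -/
def unitField (B : Space → Space) (x : Space) : Space := (fieldStrength B x)⁻¹ • B x

/-- `|B|'`, the derivative of `|B|` with respect to arclength along the fieldlines. -/
def strengthDeriv (B : Space → Space) (x : Space) : ℝ :=
  fderiv ℝ (fieldStrength B) x (unitField B x)

/-- `|B|''`, the second derivative of `|B|` along the fieldlines. -/
def strengthDeriv2 (B : Space → Space) (x : Space) : ℝ :=
  fderiv ℝ (strengthDeriv B) x (unitField B x)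

/-- `Σ⁻`: nondegenerate local maxima of `|B|` along fieldlines, in the region `U`. -/
def SigmaMinus (B : Space → Space) (U : Set Space) : Set Space :=
  {x | x ∈ U ∧ strengthDeriv B x = 0 ∧ strengthDeriv2 B x < 0}

/-- `Σ⁰`: degenerate critical points of `|B|` along fieldlines, in the region `U`. -/
def SigmaZero (B : Space → Space) (U : Set Space) : Set Space :=
  {x | x ∈ U ∧ strengthDeriv B x = 0 ∧ strengthDeriv2 B x = 0}

/-- The tangent plane of the surface `Σ⁻` at `x`. The surface is an open part of the level set
`|B|' = 0`, which is regular there because `|B|'' ≠ 0`. -/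
def tangentPlane (B : Space → Space) (x : Space) : Submodule ℝ Space :=
  LinearMap.ker (fderiv ℝ (strengthDeriv B) x).toLinearMap

/-! ### Segments of fieldline from `Σ⁻` to the first bounce point -/

/-- `γ`, on `[0, ℓ]`, is the segment of fieldline that starts at `x`, goes in the direction `σ`
(`σ = 1` along the field, `σ = -1` against it), is parametrised by arclength measured from `x`,
and ends at the first point where `|B|` again takes its value at `x`, having been smaller in
between. -/
structure IsSegment (B : Space → Space) (U : Set Space) (σ : ℝ) (x : Space)
    (γ : ℝ → Space) (ℓ : ℝ) : Prop where
  length_pos : 0 < ℓ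
  start : γ 0 = x
  mem : ∀ s ∈ Icc 0 ℓ, γ s ∈ U
  fieldline : ∀ s ∈ Icc 0 ℓ, HasDerivWithinAt γ (σ • unitField B (γ s)) (Icc 0 ℓ) s
  below : ∀ s ∈ Ioo 0 ℓ, fieldStrength B (γ s) < fieldStrength B x
  bounce : fieldStrength B (γ ℓ) = fieldStrength B x

/-- The points of `Σ⁻` whose segment in the direction `σ` exists and is not heteroclinic: its far
end is a genuine bounce point, `|B|' ≠ 0` there. -/
def SigmaMinusReg (B : Space → Space) (U : Set Space) (σ : ℝ) : Set Space :=
  {x | x ∈ SigmaMinus B U ∧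
    ∃ (γ : ℝ → Space) (ℓ : ℝ), IsSegment B U σ x γ ℓ ∧ strengthDeriv B (γ ℓ) ≠ 0}

open Classical in
/-- The segment from `x` in the direction `σ` and its length (a zero-length one if no segment
exists). For `B` of class `C¹` without zeros the length and the curve up to it are unique. -/
def segment (B : Space → Space) (U : Set Space) (σ : ℝ) (x : Space) : (ℝ → Space) × ℝ :=
  if h : ∃ p : (ℝ → Space) × ℝ, IsSegment B U σ x p.1 p.2 then h.choose else (fun _ => x, 0)

/-- The curve of the segment. -/
def segCurve (B : Space → Space) (U : Set Space) (σ : ℝ) (x : Space) : ℝ → Space :=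
  (segment B U σ x).1

/-- The length of the segment. -/
def segLength (B : Space → Space) (U : Set Space) (σ : ℝ) (x : Space) : ℝ :=
  (segment B U σ x).2

/-- The scaled parallel speed `|u| = √(2(h - |B|))` at energy `h`, as a function of position. -/
def parSpeed (B : Space → Space) (h : ℝ) (y : Space) : ℝ :=
  Real.sqrt (2 * (h - fieldStrength B y))

/-- The separatrix action `ȷ(x) = ∫ √(2(h - |B|)) ds`, with `h = |B(x)|`, over the segment from `x`
in the direction `σ`. -/
def sepAction (B : Space → Space) (U : Set Space) (σ : ℝ) (x : Space) : ℝ :=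
  ∫ s in (0 : ℝ)..segLength B U σ x, parSpeed B (fieldStrength B x) (segCurve B U σ x s)

/-! ### The Melnikov function -/

/-- `a` is the derivative of a fieldline label along the segment `γ`: it starts from `a₀` and
solves the adjoint equation `daᵢ/ds = - aⱼ ∂ᵢbʲ` (`s` increasing along the field). -/
structure IsLabelCovector (B : Space → Space) (σ : ℝ) (γ : ℝ → Space) (ℓ : ℝ)
    (a₀ : Space →L[ℝ] ℝ) (a : ℝ → (Space →L[ℝ] ℝ)) : Prop where
  start : a 0 = a₀
  adjoint : ∀ s ∈ Icc 0 ℓ,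
    HasDerivWithinAt a (-(σ • (a s).comp (fderiv ℝ (unitField B) (γ s)))) (Icc 0 ℓ) s

open Classical in
/-- The derivative `a` of the fieldline label `h` along the segment from `x` in the direction `σ`;
it starts from `d|B|`, which extends `dh` from tangent vectors of `Σ⁻` and annihilates `b`. -/
def hCovector (B : Space → Space) (U : Set Space) (σ : ℝ) (x : Space) :
    ℝ → (Space →L[ℝ] ℝ) :=
  if H : ∃ a, IsLabelCovector B σ (segCurve B U σ x) (segLength B U σ x)
      (fderiv ℝ (fieldStrength B) x) a
  then H.choose else 0

/-- The integrand `a · curl(ub) / |B|` of the Melnikov function of the point `x`. In the curl, `h` is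
the constant `|B(x)|`. (For `σ = -1` both `u` and `ds` change sign, so that `|u|` and the length
element may be used.) -/
def melnikovIntegrand (B : Space → Space) (U : Set Space) (σ : ℝ) (x : Space) (s : ℝ) : ℝ :=
  hCovector B U σ x s
      (curl (fun y => parSpeed B (fieldStrength B x) y • unitField B y) (segCurve B U σ x s)) /
    fieldStrength B (segCurve B U σ x s)

/-- The Melnikov function `M_h = ∫ a · curl(ub) / |B| ds`. -/
def melnikov (B : Space → Space) (U : Set Space) (σ : ℝ) (x : Space) : ℝ :=
  ∫ s in (0 : ℝ)..segLength B U σ x, melnikovIntegrand B U σ x s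

/-! ### Guiding-centre dynamics and the splitting of separatrices to first order -/

/-- `dX/dτ` for the scaled first-order guiding-centre motion, `ε` being the square root of the
scaled magnetic moment: `(u B̃ + ε b × ∇|B|) / (B̃ · b)` with `B̃ = B + ε u curl b`. -/
def guidingVelocity (B : Space → Space) (ε u : ℝ) (x : Space) : Space :=
  (inner ℝ (B x + (ε * u) • curl (unitField B) x) (unitField B x) : ℝ)⁻¹ •
    (u • (B x + (ε * u) • curl (unitField B) x) +
      ε • cross (unitField B x) (gradient (fieldStrength B) x))

/-- The first-order drift: the coefficient of `ε` in `dX/dτ`. -/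
def firstOrderDrift (B : Space → Space) (u : ℝ) (x : Space) : Space :=
  deriv (fun ε => guidingVelocity B ε u x) 0

/-- The integrand of the first-order change of the label `h` from `x` to the first bounce point
along the backward (`η = 1`) or forward (`η = -1`) contracting manifold: the rate of change of the
label under the drift along the unperturbed separatrix, less its rate of change at the base point,
integrated over time, where `dτ = ds / (η |u|)`. -/
def shiftIntegrand (B : Space → Space) (U : Set Space) (σ η : ℝ) (x : Space) (s : ℝ) : ℝ :=
  (hCovector B U σ x s
      (firstOrderDrift B (η * σ * parSpeed B (fieldStrength B x) (segCurve B U σ x s))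
        (segCurve B U σ x s)) -
    hCovector B U σ x 0 (firstOrderDrift B 0 x)) /
    (η * parSpeed B (fieldStrength B x) (segCurve B U σ x s))

/-- The coefficient of `ε` in the change of the label `h` along the backward (`η = 1`) or forward
(`η = -1`) contracting manifold. -/
def firstOrderShift (B : Space → Space) (U : Set Space) (σ η : ℝ) (x : Space) : ℝ :=
  ∫ s in (0 : ℝ)..segLength B U σ x, shiftIntegrand B U σ η x s

/-- The coefficient of `ε` in the displacement in the label `h`, at the first bounce, from the
forward to the backward contracting manifold. -/
def firstOrderSplitting (B : Space → Space) (U : Set Space) (σ : ℝ) (x : Space) : ℝ :=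
  firstOrderShift B U σ 1 x - firstOrderShift B U σ (-1) x

/-- The scaled Hamiltonian `½u² + |B|` on pairs (position, scaled parallel velocity). -/
def scaledHamiltonian (B : Space → Space) (z : Space × ℝ) : ℝ :=
  z.2 ^ 2 / 2 + fieldStrength B z.1

/-- `dh` and `dȷ` are linearly dependent, as covectors on the tangent plane of `Σ⁻` at `x`. -/
def DependentAt (B : Space → Space) (U : Set Space) (σ : ℝ) (x : Space) : Prop :=
  ∃ dj : Space →L[ℝ] ℝ, HasFDerivWithinAt (sepAction B U σ) dj (SigmaMinus B U) x ∧
    ¬ LinearIndependent ℝ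
      ![(fderiv ℝ (fieldStrength B) x).comp (tangentPlane B x).subtypeL,
        dj.comp (tangentPlane B x).subtypeL]

/-- Strong isodrasticity to first order: for both directions the contracting manifolds do not
split to first order, and the Hamiltonian is constant along the components of `Σ⁰ × {0}`. -/
structure FirstOrderStronglyIsodrastic (B : Space → Space) (U : Set Space) : Prop where
  noSplitting : ∀ σ : ℝ, σ = 1 ∨ σ = -1 → ∀ x ∈ SigmaMinusReg B U σ,
    firstOrderSplitting B U σ x = 0
  constOnEdge : ∀ z, ∀ w ∈ connectedComponentIn (SigmaZero B U ×ˢ ({0} : Set ℝ)) z,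
    scaledHamiltonian B w = scaledHamiltonian B z

/-- The weak isodrasticity condition: for both directions `dh` and `dȷ` are linearly dependent on
`Σ⁻`, and `h` is constant along the components of `Σ⁰`. -/
structure WeakIsodrasticityCondition (B : Space → Space) (U : Set Space) : Prop where
  dependent : ∀ σ : ℝ, σ = 1 ∨ σ = -1 → ∀ x ∈ SigmaMinusReg B U σ, DependentAt B U σ x
  constOnEdge : ∀ x, ∀ y ∈ connectedComponentIn (SigmaZero B U) x,
    fieldStrength B y = fieldStrength B x

end GuidingCentre

end

open GuidingCentre

/-! Let `ξ`, `ζ` be tangent vectors at `x` carried along the segment by the linearised fieldline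
flow. The equation for the label covector `a` is dual to theirs, so `a(ξ)` and `a(ζ)` keep their
initial values `dh(ξ)`, `dh(ζ)`. The field `b` is itself transported, so `a(b) = |B|'(x) = 0`
throughout, and `div B = 0` makes the flux `|B| b · (ξ × ζ)` constant (`IsSegment.flux_eq`).

Differentiating `ȷ` under the integral gives `dȷ(v) = ∫ (dh(v) - d|B|(ξ)) / |u| ds`; the moving end
contributes nothing because `|u|` vanishes there. Hence `dh ∧ dȷ` has integrand `-(a ∧ d|B|)(ξ, ζ) /
|u|`. By vector algebra, using `a(b) = 0`, `(b · ∇) b = c × b` and `curl(|u| b) = |u| c + |u|⁻¹ b ×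
∇|B|`, this is the Melnikov integrand times the constant flux, plus the derivative of `σ |u| (a(ξ) b
· ζ - a(ζ) b · ξ)` (`IsSegment.integrand_identity`). The latter integrates to zero because `|u|`
vanishes at both ends.

For the splitting, the part of the drift along `b` is invisible to `a`, and the rest is even in `u`;
division by `η |u|` leaves `η` times the Melnikov integrand (`eqOn_shiftIntegrand`). Since `β` is
nonzero on the tangent plane, the vanishing of `M_h` is the same as dependence of `dh` and `dȷ`.

The analytic difficulty is the square root, singular at both ends. `√(h - |B|)` is extended by zero
past the bounce, so that all nearby actions are integrals over one interval `[0, T]`. The drop `h -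
|B|` vanishes to second order at `x`, because `|B|'' < 0`, and to first order at the bounce, because
`|B|' ≠ 0`; its variation with the initial point is of order `s`. The difference quotients of the
root are thus dominated by a multiple of `|s - ℓ|^(-1/2)`, which is integrable
(`IsControlledFlow.hasFDerivAt_integral`). -/

noncomputable section

namespace GuidingCentre

open scoped NNReal Topology Manifold ContDiff

/-! ### Ordinary differential equations: existence, Grönwall estimates, differentiability of flows.
-/

section ODE

variable {E : Type*} [NormedAddCommGroup E] [NormedSpace ℝ E]

/-- A bounded Lipschitz vector field has integral curves on every interval. -/
theorem exists_integralCurve_of_lipschitz [CompleteSpace E] {f : ℝ → E → E} {T : ℝ}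
    (hT : 0 ≤ T) {K L : ℝ≥0} (hK : ∀ t ∈ Icc 0 T, LipschitzWith K (f t))
    (hc : ∀ x, ContinuousOn (f · x) (Icc 0 T)) (hL : ∀ t ∈ Icc 0 T, ∀ x, ‖f t x‖ ≤ L) (x₀ : E) :
    ∃ y : ℝ → E, y 0 = x₀ ∧ ∀ t ∈ Icc 0 T, HasDerivWithinAt y (f t (y t)) (Icc 0 T) t := by
  -- A curve of speed at most `L` stays within `L T` of its start, so a ball of that radius serves
  -- for the whole interval and no continuation argument is needed.
  have h : IsPicardLindelof f (⟨0, left_mem_Icc.2 hT⟩ : Icc (0 : ℝ) T) x₀ (L * T.toNNReal) 0 L K :=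
    { lipschitzOnWith := fun t ht => (hK t ht).lipschitzOnWith
      continuousOn := fun x _ => hc x
      norm_le := fun t ht x _ => hL t ht x
      mul_max_le := by simp [hT] }
  exact h.exists_eq_forall_mem_Icc_hasDerivWithinAt₀

theorem hasDerivWithinAt_Ici_of_Icc {F : Type*} [NormedAddCommGroup F] [NormedSpace ℝ F]
    {y : ℝ → F} {y' : F} {T t : ℝ} (ht : t ∈ Ico 0 T)
    (h : HasDerivWithinAt y y' (Icc 0 T) t) : HasDerivWithinAt y y' (Ici t) t :=
  h.mono_of_mem_nhdsWithin <| mem_nhdsWithin.2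
    ⟨Iio T, isOpen_Iio, ht.2, fun _ hs => ⟨ht.1.trans hs.2, le_of_lt hs.1⟩⟩

/-- Linear differential equations have solutions on the whole interval. -/
theorem exists_linear_ode {F : Type*} [NormedAddCommGroup F] [NormedSpace ℝ F]
    [FiniteDimensional ℝ F] {A : ℝ → F →L[ℝ] F} {T : ℝ} (hT : 0 ≤ T)
    (hA : ContinuousOn A (Icc 0 T)) (x₀ : F) :
    ∃ y : ℝ → F, y 0 = x₀ ∧ ∀ t ∈ Icc 0 T, HasDerivWithinAt y (A t (y t)) (Icc 0 T) t := by
  have : CompleteSpace F := FiniteDimensional.complete ℝ F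
  obtain ⟨K, hK⟩ := isCompact_Icc.exists_bound_of_continuousOn hA
  have hK0 : 0 ≤ K := (norm_nonneg _).trans (hK 0 (left_mem_Icc.2 hT))
  -- The Grönwall bound for the linear equation, plus 1 for positivity. Truncating the identity to
  -- `g` outside this ball makes the field bounded and Lipschitz; as `‖g x‖ ≤ ‖x‖`, solutions obey
  -- the same bound and never meet the truncation.
  set R : ℝ := ‖x₀‖ * Real.exp (K * T) + 1 with hR
  have hRpos : 0 < R := by positivity
  let χ : ContDiffBump (0 : F) := ⟨R, R + 1, hRpos, by linarith⟩
  let g : F → F := fun x => χ x • x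
  have hg : ContDiff ℝ 1 g := χ.contDiff.smul contDiff_id
  have hgs : HasCompactSupport g := χ.hasCompactSupport.smul_right
  obtain ⟨C, hC⟩ := hg.lipschitzWith_of_hasCompactSupport hgs one_ne_zero
  have hgle : ∀ x, ‖g x‖ ≤ ‖x‖ := fun x => by
    simp only [g, norm_smul, Real.norm_eq_abs, abs_of_nonneg χ.nonneg]
    exact mul_le_of_le_one_left (norm_nonneg _) χ.le_one
  have hgR : ∀ x, ‖g x‖ ≤ R + 1 := fun x => by
    by_cases hx : ‖x‖ ≤ R + 1
    · exact (hgle x).trans hx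
    · have : χ x = 0 := χ.zero_of_le_dist (by simpa using (not_le.1 hx).le)
      simp only [g, this, zero_smul, norm_zero]; positivity
  obtain ⟨y, hy0, hy⟩ := exists_integralCurve_of_lipschitz (f := fun t x => A t (g x)) hT
    (K := K.toNNReal * C) (L := K.toNNReal * (R + 1).toNNReal)
    (fun t ht => LipschitzWith.comp ((A t).lipschitz.weaken (by
      rw [← NNReal.coe_le_coe]; simpa [hK0] using hK t ht)) hC)
    (fun x => hA.clm_apply continuousOn_const)
    (fun t ht x => by
      push_cast
      rw [Real.coe_toNNReal _ hK0, Real.coe_toNNReal _ (by positivity)]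
      exact ((A t).le_opNorm _).trans (mul_le_mul (hK t ht) (hgR x) (norm_nonneg _) hK0)) x₀
  refine ⟨y, hy0, fun t ht => ?_⟩
  have hb : ‖y t‖ ≤ gronwallBound ‖x₀‖ K 0 (t - 0) :=
    norm_le_gronwallBound_of_norm_deriv_right_le (fun s hs => (hy s hs).continuousWithinAt)
      (fun s hs => hasDerivWithinAt_Ici_of_Icc hs (hy s (Ico_subset_Icc_self hs))) (by rw [hy0])
      (fun s hs => by
        rw [add_zero]
        exact ((A s).le_opNorm _).trans (mul_le_mul (hK s (Ico_subset_Icc_self hs)) (hgle _)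
          (norm_nonneg _) hK0)) t ht
  rw [gronwallBound_ε0, sub_zero] at hb
  have hyR : ‖y t‖ ≤ R := by
    refine hb.trans ?_
    have : Real.exp (K * t) ≤ Real.exp (K * T) :=
      Real.exp_le_exp.2 (mul_le_mul_of_nonneg_left ht.2 hK0)
    have := mul_le_mul_of_nonneg_left this (norm_nonneg x₀)
    linarith
  have hgy : g (y t) = y t := by
    have : χ (y t) = 1 := χ.one_of_mem_closedBall (by simpa using hyR)
    simp [g, this]
  simpa [hgy] using hy t ht

/-- Grönwall's inequality. It yields uniqueness of fieldlines when the initial points agree, and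
uniform Lipschitz dependence on the initial point otherwise. -/
theorem norm_flow_sub_le {X : E → E} {K : ℝ≥0} (hX : LipschitzWith K X) {T : ℝ} {y z : ℝ → E}
    (hy : ∀ t ∈ Icc 0 T, HasDerivWithinAt y (X (y t)) (Icc 0 T) t)
    (hz : ∀ t ∈ Icc 0 T, HasDerivWithinAt z (X (z t)) (Icc 0 T) t) {t : ℝ} (ht : t ∈ Icc 0 T) :
    ‖y t - z t‖ ≤ Real.exp (K * T) * ‖y 0 - z 0‖ := by
  have := dist_le_of_trajectories_ODE (v := fun _ => X) (fun _ => hX)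
    (fun s hs => (hy s hs).continuousWithinAt)
    (fun s hs => hasDerivWithinAt_Ici_of_Icc hs (hy s (Ico_subset_Icc_self hs)))
    (fun s hs => (hz s hs).continuousWithinAt)
    (fun s hs => hasDerivWithinAt_Ici_of_Icc hs (hz s (Ico_subset_Icc_self hs))) le_rfl t ht
  rw [dist_eq_norm, dist_eq_norm, sub_zero] at this
  refine this.trans ?_
  rw [mul_comm]
  gcongr
  exact ht.2

/-- The flow of a vector field is differentiable in the initial point, with derivative the solution
of the variational equation. -/
theorem hasFDerivAt_flow {X : E → E} {K : ℝ≥0} {M : ℝ} (hX : LipschitzWith K X) (hM : 0 ≤ M)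
    (hX' : ∀ y z, ‖X z - X y - fderiv ℝ X y (z - y)‖ ≤ M * ‖z - y‖ ^ 2)
    {T : ℝ} {φ : E → ℝ → E} (hφ0 : ∀ x, φ x 0 = x)
    (hφ : ∀ x, ∀ t ∈ Icc 0 T, HasDerivWithinAt (φ x) (X (φ x t)) (Icc 0 T) t)
    {x : E} {Φ : ℝ → E →L[ℝ] E} (hΦ0 : Φ 0 = ContinuousLinearMap.id ℝ E)
    (hΦ : ∀ t ∈ Icc 0 T, HasDerivWithinAt Φ ((fderiv ℝ X (φ x t)).comp (Φ t)) (Icc 0 T) t)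
    {t : ℝ} (ht : t ∈ Icc 0 T) : HasFDerivAt (fun y => φ y t) (Φ t) x := by
  set C := Real.exp (K * T)
  -- The Lipschitz constant may be zero, and the Grönwall bound below divides by the rate.
  set k : ℝ := K + 1
  have hk : 0 < k := by positivity
  have key : ∀ y, ‖φ y t - φ x t - Φ t (y - x)‖ ≤
      (M * C ^ 2 / k * (Real.exp (k * T) - 1)) * ‖y - x‖ ^ 2 := by
    intro y
    have hd : ∀ s ∈ Icc 0 T, HasDerivWithinAt (fun s => φ y s - φ x s - Φ s (y - x))
        (X (φ y s) - X (φ x s) - (fderiv ℝ X (φ x s)) (Φ s (y - x))) (Icc 0 T) s := by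
      intro s hs
      refine ((hφ y s hs).sub (hφ x s hs)).sub ?_
      simpa using (hΦ s hs).clm_apply (hasDerivWithinAt_const s (Icc 0 T) (y - x))
    have hb := norm_le_gronwallBound_of_norm_deriv_right_le
      (f := fun s => φ y s - φ x s - Φ s (y - x))
      (δ := 0) (K := k) (ε := M * C ^ 2 * ‖y - x‖ ^ 2)
      (fun s hs => (hd s hs).continuousWithinAt)
      (fun s hs => hasDerivWithinAt_Ici_of_Icc hs (hd s (Ico_subset_Icc_self hs)))
      (by simp [hφ0, hΦ0]) (fun s hs => ?_) t ht
    · refine hb.trans ?_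
      rw [gronwallBound_of_K_ne_0 hk.ne']
      simp only [zero_mul, zero_add, sub_zero]
      have : Real.exp (k * t) ≤ Real.exp (k * T) :=
        Real.exp_le_exp.2 (mul_le_mul_of_nonneg_left ht.2 hk.le)
      calc M * C ^ 2 * ‖y - x‖ ^ 2 / k * (Real.exp (k * t) - 1)
          ≤ M * C ^ 2 * ‖y - x‖ ^ 2 / k * (Real.exp (k * T) - 1) := by gcongr
        _ = _ := by ring
    · have hs' := Ico_subset_Icc_self hs
      -- The error of the linearised flow satisfies the variational equation up to the Taylor
      -- remainder of `X`, which is quadratic in `‖y - x‖`.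
      have e : X (φ y s) - X (φ x s) - (fderiv ℝ X (φ x s)) (Φ s (y - x)) =
          fderiv ℝ X (φ x s) (φ y s - φ x s - Φ s (y - x)) +
          (X (φ y s) - X (φ x s) - fderiv ℝ X (φ x s) (φ y s - φ x s)) := by
        simp only [map_sub]; abel
      have h1 : ‖φ y s - φ x s‖ ≤ C * ‖y - x‖ := by
        have := norm_flow_sub_le hX (hφ y) (hφ x) hs'
        rwa [hφ0, hφ0] at this
      have h2 : ‖fderiv ℝ X (φ x s)‖ ≤ k := (norm_fderiv_le_of_lipschitz ℝ hX).trans (by simp [k])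
      rw [e]
      refine (norm_add_le _ _).trans (add_le_add ?_ ?_)
      · exact (ContinuousLinearMap.le_opNorm _ _).trans (by gcongr)
      · refine (hX' _ _).trans ?_
        calc M * ‖φ y s - φ x s‖ ^ 2 ≤ M * (C * ‖y - x‖) ^ 2 := by gcongr
          _ = _ := by ring
  rw [hasFDerivAt_iff_isLittleO]
  have h1 : (fun y => φ y t - φ x t - Φ t (y - x)) =O[𝓝 x] fun y => ‖y - x‖ ^ 2 :=
    Asymptotics.IsBigO.of_bound _ (Filter.Eventually.of_forall fun y => by
      simpa using key y)
  refine h1.trans_isLittleO ?_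
  have := Asymptotics.isLittleO_norm_pow_id (E' := E) (n := 2) one_lt_two
  have h2 := this.comp_tendsto (k := fun y => y - x) (l' := 𝓝 x)
    (tendsto_sub_nhds_zero_iff.2 Filter.tendsto_id)
  simpa [Function.comp_def] using h2

end ODE

/-- A compactly supported `C²` map agrees with its linearisation to second order, uniformly. -/
theorem exists_quadratic_remainder {E F : Type*} [NormedAddCommGroup E] [NormedSpace ℝ E]
    [NormedAddCommGroup F] [NormedSpace ℝ F] {X : E → F} (hX : ContDiff ℝ 2 X)
    (hs : HasCompactSupport X) :
    ∃ M : ℝ, 0 ≤ M ∧ ∀ y z, ‖X z - X y - fderiv ℝ X y (z - y)‖ ≤ M * ‖z - y‖ ^ 2 := by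
  have h1 : ContDiff ℝ 1 (fderiv ℝ X) := hX.fderiv_right (by norm_num)
  obtain ⟨C, hC⟩ := h1.lipschitzWith_of_hasCompactSupport (hs.fderiv ℝ) one_ne_zero
  refine ⟨C, C.2, fun y z => ?_⟩
  -- Mean value inequality for `X - DX(y)`, whose derivative on the segment is at most `C ‖z - y‖`.
  have := Convex.norm_image_sub_le_of_norm_hasFDerivWithin_le
    (f := fun w => X w - fderiv ℝ X y w) (f' := fun w => fderiv ℝ X w - fderiv ℝ X y)
    (s := _root_.segment ℝ y z) (C := C * ‖z - y‖) (x := y) (y := z)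
    (fun w _ => (((hX.differentiable (by norm_num)) w).hasFDerivAt.sub
      (fderiv ℝ X y).hasFDerivAt).hasFDerivWithinAt)
    (fun w hw => by
      rw [← dist_eq_norm]
      refine (hC.dist_le_mul _ _).trans ?_
      gcongr
      rw [dist_eq_norm]
      exact norm_sub_le_of_mem_segment hw) (convex_segment y z)
      (left_mem_segment ℝ y z) (right_mem_segment ℝ y z)
  calc ‖X z - X y - fderiv ℝ X y (z - y)‖
      = ‖X z - fderiv ℝ X y z - (X y - fderiv ℝ X y y)‖ := by
        congr 1; rw [map_sub]; abel
    _ ≤ _ := this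
    _ = _ := by ring

/-! ### Smoothness of the field strength, the unit field and their derivatives along fieldlines. -/

section Regularity

variable {B : Space → Space} {U : Set Space}

theorem contDiffOn_fieldStrength (hB : ContDiffOn ℝ 2 B U) (hB0 : ∀ x ∈ U, B x ≠ 0) :
    ContDiffOn ℝ 2 (fieldStrength B) U := hB.norm ℝ hB0

theorem fieldStrength_pos (hB0 : ∀ x ∈ U, B x ≠ 0) {x : Space} (hx : x ∈ U) :
    0 < fieldStrength B x := norm_pos_iff.2 (hB0 x hx)

theorem contDiffOn_unitField (hB : ContDiffOn ℝ 2 B U) (hB0 : ∀ x ∈ U, B x ≠ 0) :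
    ContDiffOn ℝ 2 (unitField B) U :=
  ((contDiffOn_fieldStrength hB hB0).inv fun _ hx => (fieldStrength_pos hB0 hx).ne').smul hB

theorem contDiffOn_strengthDeriv (hU : IsOpen U) (hB : ContDiffOn ℝ 2 B U)
    (hB0 : ∀ x ∈ U, B x ≠ 0) : ContDiffOn ℝ 1 (strengthDeriv B) U :=
  ((contDiffOn_fieldStrength hB hB0).fderiv_of_isOpen hU (by norm_num)).clm_apply
    ((contDiffOn_unitField hB hB0).of_le (by norm_num))

theorem continuousOn_strengthDeriv2 (hU : IsOpen U) (hB : ContDiffOn ℝ 2 B U)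
    (hB0 : ∀ x ∈ U, B x ≠ 0) : ContinuousOn (strengthDeriv2 B) U :=
  ((contDiffOn_strengthDeriv hU hB hB0).continuousOn_fderiv_of_isOpen hU le_rfl).clm_apply
    (contDiffOn_unitField hB hB0).continuousOn

theorem hasFDerivAt_fieldStrength (hU : IsOpen U) (hB : ContDiffOn ℝ 2 B U)
    (hB0 : ∀ x ∈ U, B x ≠ 0) {x : Space} (hx : x ∈ U) :
    HasFDerivAt (fieldStrength B) (fderiv ℝ (fieldStrength B) x) x :=
  (((contDiffOn_fieldStrength hB hB0).contDiffAt (hU.mem_nhds hx)).differentiableAt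
    (by norm_num)).hasFDerivAt

theorem hasFDerivAt_unitField (hU : IsOpen U) (hB : ContDiffOn ℝ 2 B U)
    (hB0 : ∀ x ∈ U, B x ≠ 0) {x : Space} (hx : x ∈ U) :
    HasFDerivAt (unitField B) (fderiv ℝ (unitField B) x) x :=
  (((contDiffOn_unitField hB hB0).contDiffAt (hU.mem_nhds hx)).differentiableAt
    (by norm_num)).hasFDerivAt

theorem hasFDerivAt_strengthDeriv (hU : IsOpen U) (hB : ContDiffOn ℝ 2 B U)
    (hB0 : ∀ x ∈ U, B x ≠ 0) {x : Space} (hx : x ∈ U) :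
    HasFDerivAt (strengthDeriv B) (fderiv ℝ (strengthDeriv B) x) x :=
  (((contDiffOn_strengthDeriv hU hB hB0).contDiffAt (hU.mem_nhds hx)).differentiableAt
    (by norm_num)).hasFDerivAt

end Regularity

/-! ### Cutoff functions, to replace fields on `U` by compactly supported ones. -/

section Cutoff

variable {E F : Type*} [NormedAddCommGroup E] [NormedSpace ℝ E]
  [NormedAddCommGroup F] [NormedSpace ℝ F]

/-- The cutoff equals 1 on a neighbourhood of `K`, not just on `K`, so that the cut-off field has
the right derivative along the curve as well. -/
theorem exists_cutoff [FiniteDimensional ℝ E] {K U : Set E} (hK : IsCompact K)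
    (hU : IsOpen U) (hKU : K ⊆ U) :
    ∃ (V : Set E) (χ : E → ℝ), IsOpen V ∧ K ⊆ V ∧ V ⊆ U ∧ ContDiff ℝ ∞ χ ∧ HasCompactSupport χ ∧
      tsupport χ ⊆ U ∧ ∀ y ∈ V, χ y = 1 := by
  obtain ⟨L, hL, hKL, hLU⟩ := exists_compact_between hK hU hKU
  obtain ⟨f, h1, h0, -⟩ := exists_contMDiffMap_one_nhds_of_subset_interior
    (n := (⊤ : ℕ∞)) 𝓘(ℝ, E) hK.isClosed hKL
  obtain ⟨W, hW, hKW, hW1⟩ := eventually_nhdsSet_iff_exists.1 h1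
  have hsupp : tsupport f ⊆ L := closure_minimal (fun y hy => by
    by_contra h; exact hy (h0 y h)) hL.isClosed
  refine ⟨W ∩ U, f, hW.inter hU, subset_inter hKW hKU, inter_subset_right,
    f.contMDiff.contDiff, hL.of_isClosed_subset (isClosed_tsupport _) hsupp,
    hsupp.trans hLU, fun y hy => hW1 y hy.1⟩

theorem contDiff_cutoff_smul {U : Set E} {χ : E → ℝ} (hU : IsOpen U) (hχ : ContDiff ℝ ∞ χ)
    (hs : tsupport χ ⊆ U) {n : ℕ} {g : E → F} (hg : ContDiffOn ℝ n g U) :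
    ContDiff ℝ n fun y => χ y • g y := by
  refine contDiff_iff_contDiffAt.2 fun x => ?_
  by_cases hx : x ∈ tsupport χ
  · exact (hχ.of_le (by exact_mod_cast le_top)).contDiffAt.smul
      (hg.contDiffAt (hU.mem_nhds (hs hx)))
  · refine (contDiffAt_const (c := (0 : F))).congr_of_eventuallyEq ?_
    filter_upwards [notMem_tsupport_iff_eventuallyEq.1 hx] with y hy
    simp [hy]

end Cutoff

/-- Fieldlines are determined by their initial point. -/
theorem fieldline_unique {B : Space → Space} {U : Set Space} (hU : IsOpen U)
    (hB : ContDiffOn ℝ 2 B U) (hB0 : ∀ x ∈ U, B x ≠ 0) {σ T : ℝ} {y z : ℝ → Space}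
    (h0 : y 0 = z 0) (hyU : ∀ t ∈ Icc 0 T, y t ∈ U) (hzU : ∀ t ∈ Icc 0 T, z t ∈ U)
    (hy : ∀ t ∈ Icc 0 T, HasDerivWithinAt y (σ • unitField B (y t)) (Icc 0 T) t)
    (hz : ∀ t ∈ Icc 0 T, HasDerivWithinAt z (σ • unitField B (z t)) (Icc 0 T) t) :
    EqOn y z (Icc 0 T) := by
  have hK : IsCompact (y '' Icc 0 T ∪ z '' Icc 0 T) :=
    (isCompact_Icc.image_of_continuousOn fun s hs => (hy s hs).continuousWithinAt).union
      (isCompact_Icc.image_of_continuousOn fun s hs => (hz s hs).continuousWithinAt)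
  obtain ⟨V, χ, -, hKV, -, hχ, hχc, hχs, hχ1⟩ := exists_cutoff hK hU
    (union_subset (image_subset_iff.2 hyU) (image_subset_iff.2 hzU))
  have hX : ContDiff ℝ 2 fun y => χ y • (σ • unitField B y) :=
    contDiff_cutoff_smul (n := 2) hU hχ hχs ((contDiffOn_unitField hB hB0).const_smul σ)
  obtain ⟨K, hKX⟩ := hX.lipschitzWith_of_hasCompactSupport hχc.smul_right two_ne_zero
  intro t ht
  have := norm_flow_sub_le hKX (y := y) (z := z)
    (fun s hs => by simpa [hχ1 _ (hKV (Or.inl (mem_image_of_mem y hs)))] using hy s hs)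
    (fun s hs => by simpa [hχ1 _ (hKV (Or.inr (mem_image_of_mem z hs)))] using hz s hs) ht
  rw [h0, sub_self, norm_zero, mul_zero] at this
  exact sub_eq_zero.1 (norm_le_zero_iff.1 this)

/-- `φ` is the flow of `σ b` near `x` for times in `[0, T]`, and `Φ` its derivative at `x`. -/
structure IsLocalFlow (B : Space → Space) (U : Set Space) (σ : ℝ) (x : Space) (T C : ℝ)
    (φ : Space → ℝ → Space) (Φ : ℝ → Space →L[ℝ] Space) : Prop where
  init : ∀ y, φ y 0 = y
  nonneg : 0 ≤ C
  lip : ∀ y, ∀ t ∈ Icc 0 T, ‖φ y t - φ x t‖ ≤ C * ‖y - x‖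
  field : ∀ᶠ y in 𝓝 x, ∀ t ∈ Icc 0 T,
    φ y t ∈ U ∧ HasDerivWithinAt (φ y) (σ • unitField B (φ y t)) (Icc 0 T) t
  var_init : Φ 0 = ContinuousLinearMap.id ℝ Space
  var : ∀ t ∈ Icc 0 T,
    HasDerivWithinAt Φ (σ • (fderiv ℝ (unitField B) (φ x t)).comp (Φ t)) (Icc 0 T) t
  diff : ∀ t ∈ Icc 0 T, HasFDerivAt (fun y => φ y t) (Φ t) x
  strength_lip : ∀ᶠ y in 𝓝 x, ∀ t ∈ Icc 0 T,
    |strengthDeriv B (φ y t) - strengthDeriv B (φ x t)| ≤ C * ‖y - x‖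

theorem IsLocalFlow.mono {B : Space → Space} {U : Set Space} {σ : ℝ} {x : Space} {T T' C : ℝ}
    {φ : Space → ℝ → Space} {Φ : ℝ → Space →L[ℝ] Space} (h : IsLocalFlow B U σ x T C φ Φ)
    (hT : T' ≤ T) : IsLocalFlow B U σ x T' C φ Φ := by
  have hI : Icc 0 T' ⊆ Icc 0 T := Icc_subset_Icc_right hT
  exact
    { init := h.init
      nonneg := h.nonneg
      lip := fun y t ht => h.lip y t (hI ht)
      field := h.field.mono fun y hy t ht => ⟨(hy t (hI ht)).1, (hy t (hI ht)).2.mono hI⟩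
      var_init := h.var_init
      var := fun t ht => (h.var t (hI ht)).mono hI
      diff := fun t ht => h.diff t (hI ht)
      strength_lip := h.strength_lip.mono fun y hy t ht => hy t (hI ht) }

/-- Cutting off `σ b` near the segment gives a globally Lipschitz field with a flow for all initial
points, and on a tube around the segment this is the true fieldline flow. The time `T` exceeds `ℓ`
because neighbouring points may bounce later than `x`. -/
theorem exists_isLocalFlow {B : Space → Space} {U : Set Space} (hU : IsOpen U)
    (hB : ContDiffOn ℝ 2 B U) (hB0 : ∀ x ∈ U, B x ≠ 0) {σ ℓ : ℝ} {x : Space} {γ : ℝ → Space}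
    (hℓ : 0 < ℓ) (h0 : γ 0 = x) (hγU : ∀ t ∈ Icc 0 ℓ, γ t ∈ U)
    (hγ : ∀ t ∈ Icc 0 ℓ, HasDerivWithinAt γ (σ • unitField B (γ t)) (Icc 0 ℓ) t) :
    ∃ (T C : ℝ) (φ : Space → ℝ → Space) (Φ : ℝ → Space →L[ℝ] Space), ℓ < T ∧
      IsLocalFlow B U σ x T C φ Φ ∧ EqOn (φ x) γ (Icc 0 ℓ) := by
  have hK : IsCompact (γ '' Icc 0 ℓ) :=
    isCompact_Icc.image_of_continuousOn fun s hs => (hγ s hs).continuousWithinAt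
  obtain ⟨V, χ, hV, hKV, hVU, hχ, hχc, hχs, hχ1⟩ := exists_cutoff hK hU (image_subset_iff.2 hγU)
  set X : Space → Space := fun y => χ y • (σ • unitField B y) with hXdef
  have hX : ContDiff ℝ 2 X :=
    contDiff_cutoff_smul (n := 2) hU hχ hχs ((contDiffOn_unitField hB hB0).const_smul σ)
  have hXc : HasCompactSupport X := hχc.smul_right
  have hXV : ∀ y ∈ V, X y = σ • unitField B y := fun y hy => by simp [hXdef, hχ1 y hy]
  obtain ⟨k, hk⟩ := hX.lipschitzWith_of_hasCompactSupport hXc two_ne_zero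
  obtain ⟨L, hL⟩ := hXc.exists_bound_of_continuous hX.continuous
  obtain ⟨M, hM, hXM⟩ := exists_quadratic_remainder hX hXc
  have hT0 : (0 : ℝ) ≤ ℓ + 1 := by positivity
  choose φ hφ0 hφ using fun y => exists_integralCurve_of_lipschitz (f := fun _ => X) hT0
    (K := k) (L := L.toNNReal) (fun _ _ => hk) (fun _ => continuousOn_const)
    (fun _ _ y => (hL y).trans (Real.le_coe_toNNReal L)) y
  have hφc : ContinuousOn (φ x) (Icc 0 (ℓ + 1)) := fun s hs => (hφ x s hs).continuousWithinAt
  obtain ⟨Φ, hΦ0, hΦ⟩ := exists_linear_ode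
    (A := fun t => ContinuousLinearMap.compL ℝ Space Space Space (fderiv ℝ X (φ x t))) hT0
    ((ContinuousLinearMap.compL ℝ Space Space Space).continuous.comp_continuousOn
      ((hX.continuous_fderiv two_ne_zero).comp_continuousOn hφc))
    (ContinuousLinearMap.id ℝ Space)
  have heq : EqOn (φ x) γ (Icc 0 ℓ) := by
    intro t ht
    have := norm_flow_sub_le hk (y := φ x) (z := γ) (T := ℓ)
      (fun s hs => (hφ x s ⟨hs.1, hs.2.trans (by linarith)⟩).mono
        (Icc_subset_Icc_right (by linarith)))
      (fun s hs => by simpa [hXV _ (hKV (mem_image_of_mem γ hs))] using hγ s hs) ht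
    rw [hφ0, h0, sub_self, norm_zero, mul_zero] at this
    exact sub_eq_zero.1 (norm_le_zero_iff.1 this)
  -- The set where the cutoff is 1 is open and contains the end of the segment, so the curve stays
  -- in it a little longer.
  obtain ⟨T, hℓT, hT1, hTV⟩ : ∃ T, ℓ < T ∧ T ≤ ℓ + 1 ∧ ∀ t ∈ Icc 0 T, φ x t ∈ V := by
    have h1 : ContinuousWithinAt (φ x) (Icc 0 (ℓ + 1)) ℓ := hφc ℓ ⟨hℓ.le, by linarith⟩
    have h2 : φ x ℓ ∈ V := by
      rw [heq ⟨hℓ.le, le_rfl⟩]; exact hKV (mem_image_of_mem γ ⟨hℓ.le, le_rfl⟩)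
    obtain ⟨ε, hε, hεV⟩ := Metric.mem_nhdsWithin_iff.1 (h1 (hV.mem_nhds h2))
    refine ⟨ℓ + min (ε / 2) 1, by simp [hε], by simp, fun t ht => ?_⟩
    rcases le_or_gt t ℓ with h | h
    · rw [heq ⟨ht.1, h⟩]; exact hKV (mem_image_of_mem γ ⟨ht.1, h⟩)
    · refine hεV ⟨?_, ht.1, ht.2.trans (by simp)⟩
      rw [Metric.mem_ball, Real.dist_eq, abs_of_pos (by linarith)]
      have := ht.2.trans (add_le_add_right (min_le_left (ε / 2) 1) ℓ)
      linarith
  have hI : Icc 0 T ⊆ Icc 0 (ℓ + 1) := Icc_subset_Icc_right hT1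
  have hK2 : IsCompact (φ x '' Icc 0 T) := isCompact_Icc.image_of_continuousOn (hφc.mono hI)
  obtain ⟨r, hr, hrV⟩ := hK2.exists_thickening_subset_open hV (image_subset_iff.2 hTV)
  set C := Real.exp (k * (ℓ + 1)) with hC
  have hlip : ∀ y, ∀ t ∈ Icc 0 (ℓ + 1), ‖φ y t - φ x t‖ ≤ C * ‖y - x‖ := fun y t ht => by
    simpa only [hφ0] using norm_flow_sub_le hk (hφ y) (hφ x) ht
  have hev : ∀ᶠ y in 𝓝 x, ∀ t ∈ Icc 0 T, φ y t ∈ V := by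
    have : ∀ᶠ y in 𝓝 x, C * ‖y - x‖ < r := by
      have hc : Continuous fun y : Space => C * ‖y - x‖ := by fun_prop
      exact hc.continuousAt.eventually_lt continuousAt_const (by simpa using hr)
    filter_upwards [this] with y hy t ht
    refine hrV (Metric.mem_thickening_iff.2 ⟨φ x t, mem_image_of_mem _ ht, ?_⟩)
    rw [dist_eq_norm]
    exact (hlip y t (hI ht)).trans_lt hy
  -- `|B|'` is only `C¹` on `U`; cutting it off makes it globally Lipschitz.
  have hg : ContDiff ℝ 1 fun y => χ y • strengthDeriv B y :=
    contDiff_cutoff_smul (n := 1) hU hχ hχs (contDiffOn_strengthDeriv hU hB hB0)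
  obtain ⟨G, hG⟩ := hg.lipschitzWith_of_hasCompactSupport hχc.smul_right one_ne_zero
  have hC0 : 0 ≤ C := (Real.exp_pos _).le
  have hCm : C ≤ max C (G * C) := le_max_left _ _
  refine ⟨T, max C (G * C), φ, Φ, hℓT, ?_, heq⟩
  exact
    { init := hφ0
      nonneg := hC0.trans hCm
      lip := fun y t ht => (hlip y t (hI ht)).trans (by gcongr)
      field := by
        filter_upwards [hev] with y hy t ht
        refine ⟨hVU (hy t ht), ?_⟩
        rw [← hXV _ (hy t ht)]
        exact (hφ y t (hI ht)).mono hI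
      var_init := hΦ0
      var := fun t ht => by
        have h1 : fderiv ℝ X (φ x t) = σ • fderiv ℝ (unitField B) (φ x t) := by
          have : X =ᶠ[𝓝 (φ x t)] σ • unitField B := by
            filter_upwards [hV.mem_nhds (hTV t ht)] with y hy using hXV y hy
          rw [this.fderiv_eq]
          exact fderiv_const_smul (hasFDerivAt_unitField hU hB hB0
            (hVU (hTV t ht))).differentiableAt σ
        have := (hΦ t (hI ht)).mono hI
        simpa [h1] using this
      diff := fun t ht => hasFDerivAt_flow hk hM hXM hφ0 hφ hΦ0 (fun s hs => by
        simpa using hΦ s hs) (hI ht)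
      strength_lip := by
        filter_upwards [hev] with y hy t ht
        have := hG.dist_le_mul (φ y t) (φ x t)
        simp only [Pi.smul_apply', hχ1 _ (hy t ht), hχ1 _ (hTV t ht), one_smul, dist_eq_norm] at this
        refine this.trans ?_
        calc (G : ℝ) * ‖φ y t - φ x t‖ ≤ G * (C * ‖y - x‖) := by
              gcongr; exact hlip y t (hI ht)
          _ = (G * C) * ‖y - x‖ := by ring
          _ ≤ _ := by gcongr; exact le_max_right _ _ }

/-! ### Segments are unique -/

section Segment

variable {B : Space → Space} {U : Set Space} {σ : ℝ} {x : Space}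

/-- The two curves agree as long as both run. If the second were longer, the bounce of the first
would be an interior point of it, where `|B|` is strictly below its initial value. -/
theorem IsSegment.length_le {γ₁ γ₂ : ℝ → Space} {ℓ₁ ℓ₂ : ℝ} (hU : IsOpen U)
    (hB : ContDiffOn ℝ 2 B U) (hB0 : ∀ x ∈ U, B x ≠ 0) (h₁ : IsSegment B U σ x γ₁ ℓ₁)
    (h₂ : IsSegment B U σ x γ₂ ℓ₂) (hle : ℓ₁ ≤ ℓ₂) : ℓ₂ ≤ ℓ₁ ∧ EqOn γ₁ γ₂ (Icc 0 ℓ₁) := by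
  have hI : Icc 0 ℓ₁ ⊆ Icc 0 ℓ₂ := Icc_subset_Icc_right hle
  have heq : EqOn γ₁ γ₂ (Icc 0 ℓ₁) := fieldline_unique hU hB hB0 (h₁.start.trans h₂.start.symm)
    h₁.mem (fun t ht => h₂.mem t (hI ht)) h₁.fieldline
    (fun t ht => (h₂.fieldline t (hI ht)).mono hI)
  refine ⟨?_, heq⟩
  by_contra! hlt
  have h := h₂.below ℓ₁ ⟨h₁.length_pos, hlt⟩
  rw [← heq ⟨h₁.length_pos.le, le_rfl⟩, h₁.bounce] at h
  exact lt_irrefl _ h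

theorem IsSegment.unique {γ₁ γ₂ : ℝ → Space} {ℓ₁ ℓ₂ : ℝ} (hU : IsOpen U)
    (hB : ContDiffOn ℝ 2 B U) (hB0 : ∀ x ∈ U, B x ≠ 0) (h₁ : IsSegment B U σ x γ₁ ℓ₁)
    (h₂ : IsSegment B U σ x γ₂ ℓ₂) : ℓ₁ = ℓ₂ ∧ EqOn γ₁ γ₂ (Icc 0 ℓ₁) := by
  rcases le_total ℓ₁ ℓ₂ with h | h
  · obtain ⟨h', he⟩ := h₁.length_le hU hB hB0 h₂ h
    exact ⟨le_antisymm h h', he⟩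
  · obtain ⟨h', he⟩ := h₂.length_le hU hB hB0 h₁ h
    have e := le_antisymm h' h
    exact ⟨e, fun t ht => (he (e ▸ ht)).symm⟩

theorem IsSegment.isSegment_segCurve {γ : ℝ → Space} {ℓ : ℝ} (h : IsSegment B U σ x γ ℓ) :
    IsSegment B U σ x (segCurve B U σ x) (segLength B U σ x) := by
  have H : ∃ p : (ℝ → Space) × ℝ, IsSegment B U σ x p.1 p.2 := ⟨(γ, ℓ), h⟩
  unfold segCurve segLength GuidingCentre.segment
  rw [dif_pos H]
  exact H.choose_spec

theorem IsSegment.sepAction_eq {γ : ℝ → Space} {ℓ : ℝ} (hU : IsOpen U)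
    (hB : ContDiffOn ℝ 2 B U) (hB0 : ∀ x ∈ U, B x ≠ 0) (h : IsSegment B U σ x γ ℓ) :
    sepAction B U σ x = ∫ s in (0 : ℝ)..ℓ, parSpeed B (fieldStrength B x) (γ s) := by
  obtain ⟨e, he⟩ := h.unique hU hB hB0 h.isSegment_segCurve
  unfold sepAction
  rw [← e]
  refine intervalIntegral.integral_congr fun s hs => ?_
  rw [uIcc_of_le h.length_pos.le] at hs
  simp only [he hs]

theorem isSegment_of_mem_sigmaMinusReg (hU : IsOpen U) (hB : ContDiffOn ℝ 2 B U)
    (hB0 : ∀ x ∈ U, B x ≠ 0) (hx : x ∈ SigmaMinusReg B U σ) :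
    IsSegment B U σ x (segCurve B U σ x) (segLength B U σ x) ∧
      strengthDeriv B (segCurve B U σ x (segLength B U σ x)) ≠ 0 := by
  obtain ⟨-, γ, ℓ, h, hne⟩ := hx
  obtain ⟨e, he⟩ := h.unique hU hB hB0 h.isSegment_segCurve
  refine ⟨h.isSegment_segCurve, ?_⟩
  rwa [← e, ← he ⟨h.length_pos.le, le_rfl⟩]

end Segment

/-! ### Real-variable estimates -/

theorem monotoneOn_Icc_of_hasDerivWithinAt_nonneg {g g' : ℝ → ℝ} {a b : ℝ}
    (hg : ∀ t ∈ Icc a b, HasDerivWithinAt g (g' t) (Icc a b) t) (h0 : ∀ t ∈ Icc a b, 0 ≤ g' t) :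
    MonotoneOn g (Icc a b) :=
  monotoneOn_of_hasDerivWithinAt_nonneg (convex_Icc a b)
    (fun t ht => (hg t ht).continuousWithinAt)
    (fun t ht => (hg t (interior_subset ht)).mono interior_subset)
    (fun t ht => h0 t (interior_subset ht))

/-- Rationalise the difference of roots. Since the root of a negative number is 0, the bound also
holds when either argument is negative, so one estimate covers both sides of the bounce. -/
theorem abs_sqrt_sub_sqrt_le {a b : ℝ} (hb : b ≠ 0) :
    |√a - √b| ≤ |a - b| / √|b| := by
  have hb' : 0 < √|b| := Real.sqrt_pos.2 (abs_pos.2 hb)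
  rw [le_div_iff₀ hb']
  rcases lt_or_gt_of_ne hb with h | h
  · rw [Real.sqrt_eq_zero_of_nonpos h.le, sub_zero, abs_of_nonneg (Real.sqrt_nonneg _)]
    rcases le_or_gt a 0 with ha | ha
    · rw [Real.sqrt_eq_zero_of_nonpos ha, zero_mul]; exact abs_nonneg _
    · rw [abs_of_neg h, abs_of_pos (by linarith)]
      nlinarith [Real.sq_sqrt ha.le, Real.sq_sqrt (show 0 ≤ -b by linarith),
        sq_nonneg (√a - √(-b)), Real.sqrt_nonneg a, Real.sqrt_nonneg (-b)]
  · rw [abs_of_pos h]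
    rcases le_or_gt a 0 with ha | ha
    · rw [Real.sqrt_eq_zero_of_nonpos ha, zero_sub, abs_neg, abs_of_nonneg (Real.sqrt_nonneg _),
        Real.mul_self_sqrt h.le, abs_of_neg (by linarith)]
      linarith
    · have e : a - b = (√a - √b) * (√a + √b) := by
        ring_nf; rw [Real.sq_sqrt ha.le, Real.sq_sqrt h.le]
      rw [e, abs_mul, abs_of_nonneg (show 0 ≤ √a + √b by positivity)]
      gcongr
      linarith [Real.sqrt_nonneg a]

theorem intervalIntegrable_inv_sqrt_abs_sub (a b c : ℝ) :
    IntervalIntegrable (fun s => (√|s - c|)⁻¹) volume a b := by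
  have h0 : ∀ d : ℝ, 0 ≤ d → IntervalIntegrable (fun s => (√|s|)⁻¹) volume 0 d := fun d hd => by
    refine (intervalIntegral.intervalIntegrable_rpow' (a := 0) (b := d)
      (show (-1 : ℝ) < -(1 / 2) by norm_num)).congr fun s hs => ?_
    rw [uIoc_of_le hd] at hs
    rw [abs_of_pos hs.1, Real.rpow_neg hs.1.le, Real.sqrt_eq_rpow]
  have h1 : ∀ d : ℝ, IntervalIntegrable (fun s => (√|s|)⁻¹) volume 0 d := fun d => by
    rcases le_total 0 d with hd | hd
    · exact h0 d hd
    · have := (h0 (-d) (by linarith)).comp_sub_left 0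
      simpa using this
  have h2 := ((h1 (a - c)).symm.trans (h1 (b - c))).comp_sub_right c
  simpa using h2

/-! ### The drop of field strength along nearby fieldlines, and its control near both ends. -/

section Deficit

variable {B : Space → Space} {U : Set Space} {σ : ℝ} {x : Space} {T C : ℝ}
  {φ : Space → ℝ → Space} {Φ : ℝ → Space →L[ℝ] Space}

/-- The drop `h(y) - |B|` of the field strength along the fieldline from `y`, corrected by a term
that vanishes for `y` in `Σ⁻` so that it is of second order in `s` for all `y`. -/
def deficit (B : Space → Space) (σ : ℝ) (φ : Space → ℝ → Space) (y : Space) (s : ℝ) : ℝ :=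
  fieldStrength B y - fieldStrength B (φ y s) + σ * s * strengthDeriv B y

theorem IsLocalFlow.continuousOn (hφ : IsLocalFlow B U σ x T C φ Φ) :
    ContinuousOn (φ x) (Icc 0 T) := fun s hs =>
  (hφ.field.self_of_nhds s hs).2.continuousWithinAt

theorem IsLocalFlow.eventually_mem (hφ : IsLocalFlow B U σ x T C φ Φ) {t : ℝ}
    (ht : t ∈ Icc 0 T) {W : Set Space} (hW : W ∈ 𝓝 (φ x t)) :
    ∃ ε > 0, ∀ᶠ y in 𝓝 x, ∀ s ∈ Icc 0 T, |s - t| < ε → φ y s ∈ W := by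
  obtain ⟨r, hr, hrW⟩ := Metric.mem_nhds_iff.1 hW
  obtain ⟨ε, hε, h⟩ := Metric.mem_nhdsWithin_iff.1
    (hφ.continuousOn t ht (Metric.ball_mem_nhds _ (half_pos hr)))
  refine ⟨ε, hε, ?_⟩
  have : ∀ᶠ y in 𝓝 x, C * ‖y - x‖ < r / 2 := by
    have hc : Continuous fun y : Space => C * ‖y - x‖ := by fun_prop
    exact hc.continuousAt.eventually_lt continuousAt_const (by simpa using half_pos hr)
  filter_upwards [this] with y hy s hs hst
  refine hrW (Metric.mem_ball.2 ?_)
  have h1 : dist (φ x s) (φ x t) < r / 2 := h ⟨by rwa [Metric.mem_ball, Real.dist_eq], hs⟩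
  have h2 : dist (φ y s) (φ x s) < r / 2 := by
    rw [dist_eq_norm]; exact (hφ.lip y s hs).trans_lt hy
  linarith [dist_triangle (φ y s) (φ x s) (φ x t)]

/-- Along fieldlines `|B|` changes at the rate `σ |B|'`. -/
theorem hasDerivWithinAt_fieldStrength_comp (hU : IsOpen U) (hB : ContDiffOn ℝ 2 B U)
    (hB0 : ∀ x ∈ U, B x ≠ 0) {γ : ℝ → Space} {S : Set ℝ} {s : ℝ} (hs : γ s ∈ U)
    (hγ : HasDerivWithinAt γ (σ • unitField B (γ s)) S s) :
    HasDerivWithinAt (fun s => fieldStrength B (γ s)) (σ * strengthDeriv B (γ s)) S s := by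
  have h := (hasFDerivAt_fieldStrength hU hB hB0 hs).comp_hasDerivWithinAt s hγ
  rw [map_smul] at h
  exact h

/-- Along fieldlines `|B|'` changes at the rate `σ |B|''`. -/
theorem hasDerivWithinAt_strengthDeriv_comp (hU : IsOpen U) (hB : ContDiffOn ℝ 2 B U)
    (hB0 : ∀ x ∈ U, B x ≠ 0) {γ : ℝ → Space} {S : Set ℝ} {s : ℝ} (hs : γ s ∈ U)
    (hγ : HasDerivWithinAt γ (σ • unitField B (γ s)) S s) :
    HasDerivWithinAt (fun s => strengthDeriv B (γ s)) (σ * strengthDeriv2 B (γ s)) S s := by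
  have h := (hasFDerivAt_strengthDeriv hU hB hB0 hs).comp_hasDerivWithinAt s hγ
  rw [map_smul] at h
  exact h

theorem hasDerivWithinAt_deficit (hU : IsOpen U) (hB : ContDiffOn ℝ 2 B U)
    (hB0 : ∀ x ∈ U, B x ≠ 0) {y : Space} {S : Set ℝ} {s : ℝ} (hs : φ y s ∈ U)
    (hγ : HasDerivWithinAt (φ y) (σ • unitField B (φ y s)) S s) :
    HasDerivWithinAt (deficit B σ φ y) (σ * strengthDeriv B y - σ * strengthDeriv B (φ y s))
      S s := by
  have h := ((hasDerivWithinAt_fieldStrength_comp hU hB hB0 hs hγ).const_sub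
    (fieldStrength B y)).add
    (((hasDerivWithinAt_id s S).const_mul σ).mul_const (strengthDeriv B y))
  convert! h using 1
  ring

theorem IsLocalFlow.deficit_zero (hφ : IsLocalFlow B U σ x T C φ Φ) (y : Space) :
    deficit B σ φ y 0 = 0 := by
  simp [deficit, hφ.init]

theorem deficit_of_strengthDeriv_eq_zero {y : Space} (hy : strengthDeriv B y = 0) (s : ℝ) :
    deficit B σ φ y s = fieldStrength B y - fieldStrength B (φ y s) := by
  simp [deficit, hy]

/-- Both deficits vanish at `s = 0`, and their `s`-derivatives differ by two differences of `|B|'`,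
each at most `C ‖y - x‖`. The resulting factor `s` is what compensates the zero of `|u|` at the
start. -/
theorem IsLocalFlow.abs_deficit_sub_le (hU : IsOpen U) (hB : ContDiffOn ℝ 2 B U)
    (hB0 : ∀ x ∈ U, B x ≠ 0) (hσ : |σ| = 1) (hT : 0 ≤ T) (hφ : IsLocalFlow B U σ x T C φ Φ) :
    ∀ᶠ y in 𝓝 x, ∀ s ∈ Icc 0 T,
      |deficit B σ φ y s - deficit B σ φ x s| ≤ 2 * C * ‖y - x‖ * s := by
  filter_upwards [hφ.field, hφ.strength_lip] with y hy hL s hs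
  have hx := hφ.field.self_of_nhds
  have h := norm_image_sub_le_of_norm_deriv_le_segment'
    (f := fun s => deficit B σ φ y s - deficit B σ φ x s) (C := 2 * C * ‖y - x‖)
    (fun t ht => (hasDerivWithinAt_deficit hU hB hB0 (hy t ht).1 (hy t ht).2).sub
      (hasDerivWithinAt_deficit hU hB hB0 (hx t ht).1 (hx t ht).2)) (fun t ht => ?_) s hs
  · simpa [hφ.deficit_zero] using h
  · have h1 := hL t (Ico_subset_Icc_self ht)
    have h2 := hL 0 ⟨le_rfl, hT⟩
    rw [hφ.init, hφ.init] at h2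
    have e : σ * strengthDeriv B y - σ * strengthDeriv B (φ y t) -
        (σ * strengthDeriv B x - σ * strengthDeriv B (φ x t)) =
        σ * ((strengthDeriv B y - strengthDeriv B x) -
          (strengthDeriv B (φ y t) - strengthDeriv B (φ x t))) := by ring
    rw [e, norm_mul, Real.norm_eq_abs, hσ, one_mul]
    refine (norm_sub_le _ _).trans ?_
    rw [Real.norm_eq_abs, Real.norm_eq_abs]
    linarith

/-- The derivative of the deficit with respect to the initial point. -/
def deficitDeriv (B : Space → Space) (σ : ℝ) (x : Space) (γ : ℝ → Space)
    (Φ : ℝ → Space →L[ℝ] Space) (s : ℝ) : Space →L[ℝ] ℝ :=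
  fderiv ℝ (fieldStrength B) x - (fderiv ℝ (fieldStrength B) (γ s)).comp (Φ s) +
    (σ * s) • fderiv ℝ (strengthDeriv B) x

theorem IsLocalFlow.hasFDerivAt_deficit (hU : IsOpen U) (hB : ContDiffOn ℝ 2 B U)
    (hB0 : ∀ x ∈ U, B x ≠ 0) (hφ : IsLocalFlow B U σ x T C φ Φ) (hx : x ∈ U) {s : ℝ}
    (hs : s ∈ Icc 0 T) :
    HasFDerivAt (fun y => deficit B σ φ y s) (deficitDeriv B σ x (φ x) Φ s) x := by
  have h1 := (hasFDerivAt_fieldStrength hU hB hB0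
    (hφ.field.self_of_nhds s hs).1).comp x (hφ.diff s hs)
  exact ((hasFDerivAt_fieldStrength hU hB hB0 hx).sub h1).add
    ((hasFDerivAt_strengthDeriv hU hB hB0 hx).const_mul (σ * s))

theorem IsLocalFlow.continuousOn_deficitDeriv (hU : IsOpen U) (hB : ContDiffOn ℝ 2 B U)
    (hB0 : ∀ x ∈ U, B x ≠ 0) (hφ : IsLocalFlow B U σ x T C φ Φ) :
    ContinuousOn (deficitDeriv B σ x (φ x) Φ) (Icc 0 T) := by
  have h1 : ContinuousOn (fun s => fderiv ℝ (fieldStrength B) (φ x s)) (Icc 0 T) :=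
    ((contDiffOn_fieldStrength hB hB0).continuousOn_fderiv_of_isOpen hU (by norm_num)).comp
      hφ.continuousOn fun s hs => (hφ.field.self_of_nhds s hs).1
  have h2 : ContinuousOn Φ (Icc 0 T) := fun s hs => (hφ.var s hs).continuousWithinAt
  unfold deficitDeriv
  exact (continuousOn_const.sub (h1.clm_comp h2)).add (by fun_prop)

/-- At the far end of a segment that is not heteroclinic the field strength grows. -/
theorem IsSegment.strengthDeriv_end_pos (hU : IsOpen U) (hB : ContDiffOn ℝ 2 B U)
    (hB0 : ∀ x ∈ U, B x ≠ 0) (hσ : |σ| = 1) {γ : ℝ → Space} {ℓ : ℝ}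
    (h : IsSegment B U σ x γ ℓ) (hne : strengthDeriv B (γ ℓ) ≠ 0) :
    0 < σ * strengthDeriv B (γ ℓ) := by
  have hℓ : ℓ ∈ Icc 0 ℓ := ⟨h.length_pos.le, le_rfl⟩
  have hd := (hasDerivWithinAt_fieldStrength_comp hU hB hB0 (h.mem ℓ hℓ)
    (h.fieldline ℓ hℓ)).mono (Ioo_subset_Icc_self)
  have hσ0 : σ ≠ 0 := by rintro rfl; simp at hσ
  refine lt_of_le_of_ne ?_ (mul_ne_zero hσ0 hne).symm
  rw [hasDerivWithinAt_iff_tendsto_slope' (by simp)] at hd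
  have : (𝓝[Ioo 0 ℓ] ℓ).NeBot := right_nhdsWithin_Ioo_neBot h.length_pos
  refine ge_of_tendsto hd ?_
  filter_upwards [self_mem_nhdsWithin] with s hs
  rw [slope_def_field, h.bounce]
  have := h.below s hs
  exact div_nonneg_of_nonpos (by linarith) (by linarith [hs.2])

/-- A local flow near a segment from `x` in `Σ⁻` that is not heteroclinic, with quantitative
control of `|B|` near both ends. -/
structure IsControlledFlow (B : Space → Space) (U : Set Space) (σ : ℝ) (x : Space)
    (γ : ℝ → Space) (ℓ T C c s₀ s₁ : ℝ)
    (φ : Space → ℝ → Space) (Φ : ℝ → Space →L[ℝ] Space) : Prop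
    extends IsLocalFlow B U σ x T C φ Φ where
  eqOn : EqOn (φ x) γ (Icc 0 ℓ)
  c_pos : 0 < c
  s₀_pos : 0 < s₀
  s₀_lt : s₀ < s₁
  s₁_lt : s₁ < ℓ
  lt_T : ℓ < T
  strengthDeriv2_le : ∀ᶠ y in 𝓝 x, ∀ s ∈ Icc 0 s₀, strengthDeriv2 B (φ y s) ≤ -c
  le_strengthDeriv : ∀ᶠ y in 𝓝 x, ∀ s ∈ Icc s₁ T, c ≤ σ * strengthDeriv B (φ y s)

theorem IsSegment.exists_isControlledFlow (hU : IsOpen U) (hB : ContDiffOn ℝ 2 B U)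
    (hB0 : ∀ x ∈ U, B x ≠ 0) (hσ : |σ| = 1) (hx : x ∈ SigmaMinus B U) {γ : ℝ → Space} {ℓ : ℝ}
    (h : IsSegment B U σ x γ ℓ) (hne : strengthDeriv B (γ ℓ) ≠ 0) :
    ∃ (T C c s₀ s₁ : ℝ) (φ : Space → ℝ → Space) (Φ : ℝ → Space →L[ℝ] Space),
      IsControlledFlow B U σ x γ ℓ T C c s₀ s₁ φ Φ := by
  obtain ⟨T, C, φ, Φ, hℓT, hφ, heq⟩ :=
    exists_isLocalFlow hU hB hB0 h.length_pos h.start h.mem h.fieldline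
  have hℓ := h.length_pos
  have hend := h.strengthDeriv_end_pos hU hB hB0 hσ hne
  -- Half the limiting values of `-|B|''` at `x` and of `σ |B|'` at the bounce, so that both bounds
  -- persist for nearby points and times.
  set c := min (-strengthDeriv2 B x / 2) (σ * strengthDeriv B (γ ℓ) / 2) with hc
  have hk := hx.2.2
  have hc0 : 0 < c := lt_min (by linarith) (by linarith)
  have hW0 : {z | strengthDeriv2 B z < -c} ∈ 𝓝 (φ x 0) := by
    rw [hφ.init]
    refine ((continuousOn_strengthDeriv2 hU hB hB0).continuousAt
      (hU.mem_nhds hx.1)).eventually_lt continuousAt_const ?_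
    linarith [min_le_left (-strengthDeriv2 B x / 2) (σ * strengthDeriv B (γ ℓ) / 2)]
  have hW1 : {z | c < σ * strengthDeriv B z} ∈ 𝓝 (φ x ℓ) := by
    rw [heq ⟨hℓ.le, le_rfl⟩]
    refine continuousAt_const.eventually_lt (continuousAt_const.mul
      ((contDiffOn_strengthDeriv hU hB hB0).continuousOn.continuousAt
      (hU.mem_nhds (h.mem ℓ ⟨hℓ.le, le_rfl⟩)))) ?_
    linarith [min_le_right (-strengthDeriv2 B x / 2) (σ * strengthDeriv B (γ ℓ) / 2)]
  obtain ⟨ε₀, hε₀, h0⟩ := hφ.eventually_mem ⟨le_rfl, (hℓ.trans hℓT).le⟩ hW0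
  obtain ⟨ε₁, hε₁, h1⟩ := hφ.eventually_mem ⟨hℓ.le, hℓT.le⟩ hW1
  have hs₀ : 0 < min (ε₀ / 2) (ℓ / 3) := lt_min (by linarith) (by linarith)
  have hs₀' : min (ε₀ / 2) (ℓ / 3) ≤ ε₀ / 2 := min_le_left _ _
  have hs₀'' : min (ε₀ / 2) (ℓ / 3) ≤ ℓ / 3 := min_le_right _ _
  have hs₁ : ℓ / 2 ≤ max (ℓ - ε₁ / 2) (ℓ / 2) := le_max_right _ _
  have hs₁' : ℓ - ε₁ / 2 ≤ max (ℓ - ε₁ / 2) (ℓ / 2) := le_max_left _ _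
  have hT' : min T (ℓ + ε₁ / 2) ≤ T := min_le_left _ _
  have hT'' : min T (ℓ + ε₁ / 2) ≤ ℓ + ε₁ / 2 := min_le_right _ _
  refine ⟨min T (ℓ + ε₁ / 2), C, c, min (ε₀ / 2) (ℓ / 3), max (ℓ - ε₁ / 2) (ℓ / 2), φ, Φ, ?_⟩
  exact
    { hφ.mono hT' with
      eqOn := heq
      c_pos := hc0
      s₀_pos := hs₀
      s₀_lt := by linarith
      s₁_lt := max_lt (by linarith) (by linarith)
      lt_T := lt_min hℓT (by linarith)
      strengthDeriv2_le := by
        filter_upwards [h0] with y hy s hs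
        refine le_of_lt (hy s ⟨hs.1, by linarith [hs.2]⟩ ?_)
        rw [sub_zero, abs_of_nonneg hs.1]; linarith [hs.2]
      le_strengthDeriv := by
        filter_upwards [h1] with y hy s hs
        refine le_of_lt (hy s ⟨by linarith [hs.1], hs.2.trans hT'⟩ ?_)
        rw [abs_lt]; constructor <;> linarith [hs.1, hs.2] }

variable {γ : ℝ → Space} {ℓ c s₀ s₁ : ℝ}

/-- Integrate `|B|'' ≤ -c` twice from a critical point; `σ² = 1` removes the direction. -/
theorem le_deficit_of_strengthDeriv2_le (hU : IsOpen U) (hB : ContDiffOn ℝ 2 B U)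
    (hB0 : ∀ x ∈ U, B x ≠ 0) (hσ : |σ| = 1) {y : Space} (hy : strengthDeriv B y = 0)
    (h0 : φ y 0 = y)
    (hf : ∀ t ∈ Icc 0 s₀, φ y t ∈ U ∧
      HasDerivWithinAt (φ y) (σ • unitField B (φ y t)) (Icc 0 s₀) t)
    (h2 : ∀ s ∈ Icc 0 s₀, strengthDeriv2 B (φ y s) ≤ -c) {s : ℝ} (hs : s ∈ Icc 0 s₀) :
    c * s ^ 2 / 2 ≤ deficit B σ φ y s := by
  have hσ2 : σ * σ = 1 := by rw [← abs_mul_abs_self, hσ, one_mul]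
  have m1 : MonotoneOn (fun t => -(σ * strengthDeriv B (φ y t)) - c * t) (Icc 0 s₀) :=
    monotoneOn_Icc_of_hasDerivWithinAt_nonneg
      (g' := fun t => -(σ * (σ * strengthDeriv2 B (φ y t))) - c * 1)
      (fun t ht => ((((hasDerivWithinAt_strengthDeriv_comp hU hB hB0 (hf t ht).1
        (hf t ht).2).const_mul σ).neg).sub ((hasDerivWithinAt_id t _).const_mul c)))
      (fun t ht => by
        have := h2 t ht
        rw [← mul_assoc, hσ2]; linarith)
  have p1 : ∀ t ∈ Icc 0 s₀, 0 ≤ -(σ * strengthDeriv B (φ y t)) - c * t := fun t ht => by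
    simpa [h0, hy] using m1 ⟨le_rfl, ht.1.trans ht.2⟩ ht ht.1
  have m2 : MonotoneOn (fun t => deficit B σ φ y t - c * t ^ 2 / 2) (Icc 0 s₀) :=
    monotoneOn_Icc_of_hasDerivWithinAt_nonneg
      (g' := fun t => σ * strengthDeriv B y - σ * strengthDeriv B (φ y t) - c * t)
      (fun t ht => by
        have h3 : HasDerivWithinAt (fun t : ℝ => c * t ^ 2 / 2) (c * t) (Icc 0 s₀) t := by
          have := (((hasDerivAt_pow 2 t).const_mul c).div_const 2).hasDerivWithinAt (s := Icc 0 s₀)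
          convert! this using 1
          simp; ring
        exact (hasDerivWithinAt_deficit hU hB hB0 (hf t ht).1 (hf t ht).2).sub h3)
      (fun t ht => by
        have := p1 t ht
        rw [hy]; linarith)
  have := m2 ⟨le_rfl, hs.1.trans hs.2⟩ hs hs.1
  simp only [deficit, h0, hy] at this ⊢
  nlinarith

/-- Near the bounce the deficit decreases at rate at least `c`. This makes the bounce of a nearby
point unique and its zero simple. -/
theorem deficit_sub_le_of_le_strengthDeriv (hU : IsOpen U) (hB : ContDiffOn ℝ 2 B U)
    (hB0 : ∀ x ∈ U, B x ≠ 0) {y : Space} (hy : strengthDeriv B y = 0)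
    (hf : ∀ t ∈ Icc s₁ T, φ y t ∈ U ∧
      HasDerivWithinAt (φ y) (σ • unitField B (φ y t)) (Icc s₁ T) t)
    (h2 : ∀ s ∈ Icc s₁ T, c ≤ σ * strengthDeriv B (φ y s)) {s t : ℝ} (hs : s ∈ Icc s₁ T)
    (ht : t ∈ Icc s₁ T) (hst : s ≤ t) :
    deficit B σ φ y t + c * (t - s) ≤ deficit B σ φ y s := by
  have m : MonotoneOn (fun t => -deficit B σ φ y t - c * t) (Icc s₁ T) :=
    monotoneOn_Icc_of_hasDerivWithinAt_nonneg
      (g' := fun t => -(σ * strengthDeriv B y - σ * strengthDeriv B (φ y t)) - c * 1)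
      (fun t ht => (hasDerivWithinAt_deficit hU hB hB0 (hf t ht).1 (hf t ht).2).neg.sub
        ((hasDerivWithinAt_id t _).const_mul c))
      (fun t ht => by
        have := h2 t ht
        rw [hy]; linarith)
  have := m hs ht hst
  simp only at this
  linarith

end Deficit

/-! ### Differentiability of the separatrix action along `Σ⁻`. -/

section Action

variable {B : Space → Space} {U : Set Space} {σ : ℝ} {x : Space} {T C : ℝ}
  {φ : Space → ℝ → Space} {Φ : ℝ → Space →L[ℝ] Space} {γ : ℝ → Space} {ℓ c s₀ s₁ : ℝ}

theorem IsControlledFlow.exists_deficit_ge (hU : IsOpen U) (hB : ContDiffOn ℝ 2 B U)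
    (hB0 : ∀ x ∈ U, B x ≠ 0) (hx : strengthDeriv B x = 0)
    (hs : IsSegment B U σ x γ ℓ) (hφ : IsControlledFlow B U σ x γ ℓ T C c s₀ s₁ φ Φ) :
    ∃ m > 0, ∀ s ∈ Icc s₀ s₁, m ≤ deficit B σ φ x s := by
  have hI : Icc s₀ s₁ ⊆ Ioo 0 ℓ := fun s h => ⟨hφ.s₀_pos.trans_le h.1, h.2.trans_lt hφ.s₁_lt⟩
  have hI' : Icc s₀ s₁ ⊆ Icc 0 T := fun s h => ⟨(hI h).1.le, ((hI h).2.trans hφ.lt_T).le⟩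
  have hc : ContinuousOn (deficit B σ φ x) (Icc s₀ s₁) := fun s h =>
    ((hasDerivWithinAt_deficit hU hB hB0 (hφ.field.self_of_nhds s (hI' h)).1
      (hφ.field.self_of_nhds s (hI' h)).2).mono hI').continuousWithinAt
  obtain ⟨t, ht, hmin⟩ := isCompact_Icc.exists_isMinOn (nonempty_Icc.2 hφ.s₀_lt.le) hc
  refine ⟨deficit B σ φ x t, ?_, fun s h => hmin h⟩
  rw [deficit_of_strengthDeriv_eq_zero hx, hφ.eqOn (Ioo_subset_Icc_self (hI ht)), gt_iff_lt, sub_pos]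
  exact hs.below t (hI ht)

theorem IsControlledFlow.deficit_end (hx : strengthDeriv B x = 0)
    (hs : IsSegment B U σ x γ ℓ) (hφ : IsControlledFlow B U σ x γ ℓ T C c s₀ s₁ φ Φ) :
    deficit B σ φ x ℓ = 0 := by
  rw [deficit_of_strengthDeriv_eq_zero hx, hφ.eqOn ⟨hs.length_pos.le, le_rfl⟩, hs.bounce, sub_self]

/-- Nearby points of `Σ⁻` have nearby segments. -/
theorem IsControlledFlow.eventually_isSegment (hU : IsOpen U) (hB : ContDiffOn ℝ 2 B U)
    (hB0 : ∀ x ∈ U, B x ≠ 0) (hσ : |σ| = 1) (hx : x ∈ SigmaMinus B U)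
    (hs : IsSegment B U σ x γ ℓ) (hφ : IsControlledFlow B U σ x γ ℓ T C c s₀ s₁ φ Φ) :
    ∀ᶠ y in 𝓝 x, y ∈ SigmaMinus B U → ∃ ℓ' : ℝ, ℓ' < T ∧ IsSegment B U σ y (φ y) ℓ' ∧
      ∀ s ∈ Icc ℓ' T, deficit B σ φ y s ≤ 0 := by
  obtain ⟨m, hm, hms⟩ := hφ.exists_deficit_ge hU hB hB0 hx.2.1 hs
  have h₀ := hφ.s₀_pos
  have h₀₁ := hφ.s₀_lt
  have h₁ := hφ.s₁_lt
  have hT := hφ.lt_T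
  have hT0 : 0 < T := by linarith
  have hxT : deficit B σ φ x T < 0 := by
    have := deficit_sub_le_of_le_strengthDeriv hU hB hB0 hx.2.1 (s₁ := s₁) (T := T)
      (fun t ht => ⟨(hφ.field.self_of_nhds t ⟨by linarith [ht.1], ht.2⟩).1,
        (hφ.field.self_of_nhds t ⟨by linarith [ht.1], ht.2⟩).2.mono
          (Icc_subset_Icc_left (by linarith))⟩)
      hφ.le_strengthDeriv.self_of_nhds ⟨h₁.le, hT.le⟩ ⟨by linarith, le_rfl⟩ hT.le
    rw [hφ.deficit_end hx.2.1 hs] at this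
    nlinarith [hφ.c_pos]
  -- Closer than `m`, to keep the deficit positive on the middle range; closer than `-D(x, T)`,
  -- where `D` is the deficit, to keep it negative at `T`.
  have hCs : ∀ᶠ y in 𝓝 x, 2 * C * ‖y - x‖ * T < min m (-deficit B σ φ x T) := by
    have hc : Continuous fun y : Space => 2 * C * ‖y - x‖ * T := by fun_prop
    exact hc.continuousAt.eventually_lt continuousAt_const (by simp [hm, hxT])
  filter_upwards [hφ.field, hφ.strengthDeriv2_le, hφ.le_strengthDeriv, hCs,
    hφ.toIsLocalFlow.abs_deficit_sub_le hU hB hB0 hσ hT0.le] with y hf h2 h1 hC hL hy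
  have hclose : ∀ s ∈ Icc 0 T,
      |deficit B σ φ y s - deficit B σ φ x s| < min m (-deficit B σ φ x T) := fun s hs => by
    refine ((hL s hs).trans ?_).trans_lt hC
    have := hφ.nonneg
    gcongr
    exact hs.2
  have hpos₀ : ∀ s ∈ Ioc 0 s₀, 0 < deficit B σ φ y s := fun s hs => by
    have := le_deficit_of_strengthDeriv2_le hU hB hB0 hσ hy.2.1 (hφ.init y)
      (fun t ht => ⟨(hf t ⟨ht.1, by linarith [ht.2]⟩).1,
        (hf t ⟨ht.1, by linarith [ht.2]⟩).2.mono (Icc_subset_Icc_right (by linarith))⟩) h2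
        (Ioc_subset_Icc_self hs)
    have h3 : 0 < c * s ^ 2 / 2 := by have := hφ.c_pos; have := hs.1; positivity
    linarith
  have hposm : ∀ s ∈ Icc s₀ s₁, 0 < deficit B σ φ y s := fun s hs => by
    have h3 := hclose s ⟨by linarith [hs.1], by linarith [hs.2]⟩
    have h4 := hms s hs
    linarith [(abs_lt.1 h3).1, min_le_left m (-deficit B σ φ x T)]
  have hneg : deficit B σ φ y T < 0 := by
    have h3 := hclose T ⟨hT0.le, le_rfl⟩
    linarith [(abs_lt.1 h3).2, min_le_right m (-deficit B σ φ x T)]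
  have hanti : ∀ s ∈ Icc s₁ T, ∀ t ∈ Icc s₁ T, s ≤ t →
      deficit B σ φ y t + c * (t - s) ≤ deficit B σ φ y s := fun s hs t ht hst =>
    deficit_sub_le_of_le_strengthDeriv hU hB hB0 hy.2.1
      (fun t ht => ⟨(hf t ⟨by linarith [ht.1], ht.2⟩).1,
        (hf t ⟨by linarith [ht.1], ht.2⟩).2.mono (Icc_subset_Icc_left (by linarith))⟩)
      h1 hs ht hst
  have hcont : ContinuousOn (deficit B σ φ y) (Icc s₁ T) := fun s hs =>
    ((hasDerivWithinAt_deficit hU hB hB0 (hf s ⟨by linarith [hs.1], hs.2⟩).1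
      (hf s ⟨by linarith [hs.1], hs.2⟩).2).mono
      (Icc_subset_Icc_left (by linarith))).continuousWithinAt
  -- The bounce of `y` is the zero between the positive value at `s₁` and the negative one at `T`.
  obtain ⟨ℓ', hℓ', hℓ'0⟩ := intermediate_value_Icc' (by linarith : s₁ ≤ T) hcont
    (mem_Icc.2 ⟨hneg.le, (hposm s₁ ⟨h₀₁.le, le_rfl⟩).le⟩)
  have hℓ'T : ℓ' < T := lt_of_le_of_ne hℓ'.2 fun h => by rw [h] at hℓ'0; linarith
  have hℓ'1 : s₁ < ℓ' := lt_of_le_of_ne hℓ'.1 fun h => by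
    have := hposm s₁ ⟨h₀₁.le, le_rfl⟩
    rw [h] at this; linarith
  have hI : Icc 0 ℓ' ⊆ Icc 0 T := Icc_subset_Icc_right hℓ'T.le
  refine ⟨ℓ', hℓ'T, ?_, fun s hs => ?_⟩
  · exact
      { length_pos := by linarith
        start := hφ.init y
        mem := fun s hs => (hf s (hI hs)).1
        fieldline := fun s hs => (hf s (hI hs)).2.mono hI
        below := fun s hs => by
          rw [← sub_pos, ← deficit_of_strengthDeriv_eq_zero (σ := σ) hy.2.1]
          rcases le_or_gt s s₀ with h | h
          · exact hpos₀ s ⟨hs.1, h⟩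
          rcases le_or_gt s s₁ with h' | h'
          · exact hposm s ⟨h.le, h'⟩
          · have h3 := hanti s ⟨h'.le, by linarith [hs.2]⟩ ℓ' hℓ' hs.2.le
            nlinarith [hφ.c_pos, hs.2]
        bounce := by
          rw [deficit_of_strengthDeriv_eq_zero hy.2.1] at hℓ'0
          linarith }
  · have h3 := hanti ℓ' hℓ' s ⟨by linarith [hs.1], hs.2⟩ hs.1
    nlinarith [hφ.c_pos, hs.1]

/-- The deficit vanishes to second order at the start and to first order at the end. -/
theorem IsControlledFlow.exists_le_abs_deficit (hU : IsOpen U) (hB : ContDiffOn ℝ 2 B U)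
    (hB0 : ∀ x ∈ U, B x ≠ 0) (hσ : |σ| = 1) (hx : x ∈ SigmaMinus B U)
    (hs : IsSegment B U σ x γ ℓ) (hφ : IsControlledFlow B U σ x γ ℓ T C c s₀ s₁ φ Φ) :
    ∃ k > 0, ∀ s ∈ Icc 0 T, k * s ^ 2 * |s - ℓ| ≤ |deficit B σ φ x s| := by
  obtain ⟨m, hm, hms⟩ := hφ.exists_deficit_ge hU hB hB0 hx.2.1 hs
  have h₀ := hφ.s₀_pos
  have h₀₁ := hφ.s₀_lt
  have h₁ := hφ.s₁_lt
  have hT := hφ.lt_T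
  have hc := hφ.c_pos
  have hT0 : 0 < T := by linarith
  have hf := hφ.field.self_of_nhds
  have hanti : ∀ s ∈ Icc s₁ T, ∀ t ∈ Icc s₁ T, s ≤ t →
      deficit B σ φ x t + c * (t - s) ≤ deficit B σ φ x s := fun s hs t ht hst =>
    deficit_sub_le_of_le_strengthDeriv hU hB hB0 hx.2.1
      (fun t ht => ⟨(hf t ⟨by linarith [ht.1], ht.2⟩).1,
        (hf t ⟨by linarith [ht.1], ht.2⟩).2.mono (Icc_subset_Icc_left (by linarith))⟩)
      hφ.le_strengthDeriv.self_of_nhds hs ht hst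
  have hℓ0 := hφ.deficit_end hx.2.1 hs
  have hsℓ : ∀ s ∈ Icc 0 T, |s - ℓ| ≤ T := fun s hs => by
    rw [abs_le]; constructor <;> linarith [hs.1, hs.2]
  -- One constant for three ranges: the quadratic bound near the start, the minimum `m` in the
  -- middle, the linear bound near the bounce; the factors not needed are estimated by powers of
  -- `T`.
  refine ⟨min (c / (2 * T)) (min (m / T ^ 3) (c / T ^ 2)), by positivity, fun s hs => ?_⟩
  have k1 : min (c / (2 * T)) (min (m / T ^ 3) (c / T ^ 2)) ≤ c / (2 * T) := min_le_left _ _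
  have k2 : min (c / (2 * T)) (min (m / T ^ 3) (c / T ^ 2)) ≤ m / T ^ 3 :=
    (min_le_right _ _).trans (min_le_left _ _)
  have k3 : min (c / (2 * T)) (min (m / T ^ 3) (c / T ^ 2)) ≤ c / T ^ 2 :=
    (min_le_right _ _).trans (min_le_right _ _)
  have hs0 : 0 ≤ s := hs.1
  rcases le_or_gt s s₀ with h | h
  · have := le_deficit_of_strengthDeriv2_le hU hB hB0 hσ hx.2.1 (hφ.init x)
      (fun t ht => ⟨(hf t ⟨ht.1, by linarith [ht.2]⟩).1,
        (hf t ⟨ht.1, by linarith [ht.2]⟩).2.mono (Icc_subset_Icc_right (by linarith))⟩)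
        hφ.strengthDeriv2_le.self_of_nhds ⟨hs.1, h⟩
    calc _ ≤ c / (2 * T) * s ^ 2 * T := by gcongr; exact hsℓ s hs
      _ = c * s ^ 2 / 2 := by field_simp
      _ ≤ _ := this.trans (le_abs_self _)
  rcases le_or_gt s s₁ with h' | h'
  · calc _ ≤ m / T ^ 3 * T ^ 2 * T := by
          gcongr
          · exact hs.2
          · exact hsℓ s hs
      _ = m := by field_simp
      _ ≤ _ := (hms s ⟨h.le, h'⟩).trans (le_abs_self _)
  · have hsI : s ∈ Icc s₁ T := ⟨h'.le, hs.2⟩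
    have hℓI : ℓ ∈ Icc s₁ T := ⟨h₁.le, hT.le⟩
    have : c * |s - ℓ| ≤ |deficit B σ φ x s| := by
      rcases le_total s ℓ with hle | hle
      · have h3 := hanti s hsI ℓ hℓI hle
        rw [abs_of_nonpos (by linarith : s - ℓ ≤ 0)]
        refine le_trans ?_ (le_abs_self _)
        linarith
      · have h3 := hanti ℓ hℓI s hsI hle
        rw [abs_of_nonneg (by linarith : 0 ≤ s - ℓ)]
        refine le_trans ?_ (neg_le_abs _)
        linarith
    refine le_trans ?_ this
    calc _ ≤ c / T ^ 2 * T ^ 2 * |s - ℓ| := by gcongr; exact hs.2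
      _ = _ := by field_simp

/-- The separatrix action of nearby points of `Σ⁻`, as an integral over a fixed interval. -/
theorem IsControlledFlow.sepAction_eventuallyEq (hU : IsOpen U) (hB : ContDiffOn ℝ 2 B U)
    (hB0 : ∀ x ∈ U, B x ≠ 0) (hσ : |σ| = 1) (hx : x ∈ SigmaMinus B U)
    (hs : IsSegment B U σ x γ ℓ) (hφ : IsControlledFlow B U σ x γ ℓ T C c s₀ s₁ φ Φ) :
    ∀ᶠ y in 𝓝 x, y ∈ SigmaMinus B U →
      sepAction B U σ y = ∫ s in (0 : ℝ)..T, √(2 * deficit B σ φ y s) := by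
  filter_upwards [hφ.eventually_isSegment hU hB hB0 hσ hx hs, hφ.field] with y hy hf hyS
  obtain ⟨ℓ', hℓ', hseg, hneg⟩ := hy hyS
  have hT0 : 0 < T := hseg.length_pos.trans hℓ'
  have hcont : ContinuousOn (fun s => √(2 * deficit B σ φ y s)) (Icc 0 T) :=
    (continuousOn_const.mul fun s hs => (hasDerivWithinAt_deficit hU hB hB0 (hf s hs).1
      (hf s hs).2).continuousWithinAt).sqrt
  have hint : ∀ a ∈ Icc 0 T, ∀ b ∈ Icc 0 T,
      IntervalIntegrable (fun s => √(2 * deficit B σ φ y s)) volume a b := fun a ha b hb =>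
    (hcont.mono (by
      rw [uIcc_eq_union]
      exact union_subset (Icc_subset_Icc ha.1 hb.2) (Icc_subset_Icc hb.1 ha.2))).intervalIntegrable
  have hℓI : ℓ' ∈ Icc 0 T := ⟨hseg.length_pos.le, hℓ'.le⟩
  rw [hseg.sepAction_eq hU hB hB0, ← intervalIntegral.integral_add_adjacent_intervals
    (hint 0 ⟨le_rfl, hT0.le⟩ ℓ' hℓI) (hint ℓ' hℓI T ⟨hT0.le, le_rfl⟩)]
  -- Past the bounce the deficit is nonpositive and `Real.sqrt` returns 0, so the moving endpoint
  -- disappears from the formula.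
  have e2 : ∫ s in ℓ'..T, √(2 * deficit B σ φ y s) = 0 := by
    rw [intervalIntegral.integral_congr (g := fun _ => (0 : ℝ)) fun s hs => ?_]
    · simp
    · rw [uIcc_of_le hℓ'.le] at hs
      exact Real.sqrt_eq_zero_of_nonpos (by linarith [hneg s hs])
  rw [e2, add_zero]
  refine intervalIntegral.integral_congr fun s _ => ?_
  simp only [parSpeed, deficit_of_strengthDeriv_eq_zero hyS.2.1]

/-- The integrand of the derivative of the separatrix action. -/
def actionDerivIntegrand (B : Space → Space) (σ : ℝ) (x : Space) (φ : Space → ℝ → Space)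
    (Φ : ℝ → Space →L[ℝ] Space) (s : ℝ) : Space →L[ℝ] ℝ :=
  (√(2 * deficit B σ φ x s))⁻¹ • deficitDeriv B σ x (φ x) Φ s

/-- Differentiation of the separatrix action under the integral sign. -/
theorem IsControlledFlow.hasFDerivAt_integral (hU : IsOpen U) (hB : ContDiffOn ℝ 2 B U)
    (hB0 : ∀ x ∈ U, B x ≠ 0) (hσ : |σ| = 1) (hx : x ∈ SigmaMinus B U)
    (hs : IsSegment B U σ x γ ℓ) (hφ : IsControlledFlow B U σ x γ ℓ T C c s₀ s₁ φ Φ) :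
    IntervalIntegrable (actionDerivIntegrand B σ x φ Φ) volume 0 T ∧
      HasFDerivAt (fun y => ∫ s in (0 : ℝ)..T, √(2 * deficit B σ φ y s))
        (∫ s in (0 : ℝ)..T, actionDerivIntegrand B σ x φ Φ s) x := by
  have hT0 : 0 < T := hs.length_pos.trans hφ.lt_T
  obtain ⟨k, hk, hkD⟩ := hφ.exists_le_abs_deficit hU hB hB0 hσ hx hs
  have hcont : ∀ᶠ y in 𝓝 x, ContinuousOn (deficit B σ φ y) (Icc 0 T) := by
    filter_upwards [hφ.field] with y hf s hs
    exact (hasDerivWithinAt_deficit hU hB hB0 (hf s hs).1 (hf s hs).2).continuousWithinAt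
  have hcont' : ∀ᶠ y in 𝓝 x, ContinuousOn (fun s => √(2 * deficit B σ φ y s)) (Icc 0 T) :=
    hcont.mono fun y hy => (continuousOn_const.mul hy).sqrt
  have hm : ∀ᶠ y in 𝓝 x, AEStronglyMeasurable (fun s => √(2 * deficit B σ φ y s))
      (volume.restrict (Ioc 0 T)) := hcont'.mono fun y hy =>
    (hy.mono Ioc_subset_Icc_self).aestronglyMeasurable measurableSet_Ioc
  have hL := hφ.toIsLocalFlow.abs_deficit_sub_le hU hB hB0 hσ hT0.le
  have hne : ∀ᵐ s ∂volume.restrict (Ioc 0 T), s ∈ Ioc 0 T ∧ s ≠ ℓ := by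
    refine (ae_restrict_mem measurableSet_Ioc).and (ae_restrict_of_ae ?_)
    simp [ae_iff]
  have hDne : ∀ s ∈ Ioc 0 T, s ≠ ℓ → 0 < k * s ^ 2 * |s - ℓ| := fun s hs hsℓ => by
    have := hs.1
    have := abs_pos.2 (sub_ne_zero.2 hsℓ)
    positivity
  -- The Lipschitz estimate is needed only between `y` and `x`, not between two arbitrary nearby
  -- points. The bound is `|ΔD| / √|D|` with `|ΔD|` of order `s ‖y - x‖` and `√|D|` at least of
  -- order `s √|s - ℓ|`; the factors `s` cancel.
  have key := hasFDerivAt_integral_of_dominated_loc_of_lip' (𝕜 := ℝ)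
    (μ := volume.restrict (Ioc 0 T)) (x₀ := x)
    (s := {y | AEStronglyMeasurable (fun s => √(2 * deficit B σ φ y s))
      (volume.restrict (Ioc 0 T)) ∧ ∀ s ∈ Icc 0 T,
      |deficit B σ φ y s - deficit B σ φ x s| ≤ 2 * C * ‖y - x‖ * s})
    (F := fun y s => √(2 * deficit B σ φ y s)) (F' := actionDerivIntegrand B σ x φ Φ)
    (bound := fun s => 4 * C / √(2 * k) * (√|s - ℓ|)⁻¹)
    (hm.and hL) (fun y hy => hy.1) ?_ ?_ ?_ ?_ ?_
  · refine ⟨(intervalIntegrable_iff_integrableOn_Ioc_of_le hT0.le).2 key.1, ?_⟩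
    simpa only [intervalIntegral.integral_of_le hT0.le] using key.2
  · exact (hcont'.self_of_nhds.integrableOn_Icc).mono_set Ioc_subset_Icc_self
  · unfold actionDerivIntegrand
    refine AEStronglyMeasurable.smul (𝕜 := ℝ) (f := fun s => (√(2 * deficit B σ φ x s))⁻¹)
      (g := deficitDeriv B σ x (φ x) Φ) ?_ ?_
    · exact hm.self_of_nhds.aemeasurable.inv.aestronglyMeasurable
    · exact ((hφ.continuousOn_deficitDeriv hU hB hB0).mono
        Ioc_subset_Icc_self).aestronglyMeasurable measurableSet_Ioc
  · filter_upwards [hne] with s ⟨hs, hsℓ⟩ y hy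
    have h1 := hy.2 s (Ioc_subset_Icc_self hs)
    have h2 := hkD s (Ioc_subset_Icc_self hs)
    have h3 := hDne s hs hsℓ
    have hs0 := hs.1
    have h4 : 2 * deficit B σ φ x s ≠ 0 := by
      intro h
      have : deficit B σ φ x s = 0 := by linarith
      rw [this, abs_zero] at h2; linarith
    have h5 : √(2 * k) * s * √|s - ℓ| ≤ √|2 * deficit B σ φ x s| := by
      have : √(2 * k) * s * √|s - ℓ| = √(2 * (k * s ^ 2 * |s - ℓ|)) := by
        rw [show 2 * (k * s ^ 2 * |s - ℓ|) = (2 * k) * s ^ 2 * |s - ℓ| by ring,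
          Real.sqrt_mul (x := 2 * k * s ^ 2) (by positivity),
          Real.sqrt_mul (x := 2 * k) (by positivity) (s ^ 2), Real.sqrt_sq hs0.le]
      rw [this]
      refine Real.sqrt_le_sqrt ?_
      rw [abs_mul, abs_two]
      linarith
    have h6 : 0 < √|s - ℓ| := Real.sqrt_pos.2 (abs_pos.2 (sub_ne_zero.2 hsℓ))
    have h7 : 0 < √(2 * k) := Real.sqrt_pos.2 (by positivity)
    calc ‖√(2 * deficit B σ φ y s) - √(2 * deficit B σ φ x s)‖
        ≤ |2 * deficit B σ φ y s - 2 * deficit B σ φ x s| / √|2 * deficit B σ φ x s| :=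
          abs_sqrt_sub_sqrt_le h4
      _ ≤ (4 * C * ‖y - x‖ * s) / (√(2 * k) * s * √|s - ℓ|) := by
          have := hφ.nonneg
          gcongr
          rw [← mul_sub, abs_mul, abs_two]
          linarith
      _ = 4 * C / √(2 * k) * (√|s - ℓ|)⁻¹ * ‖y - x‖ := by
          field_simp
  · exact ((intervalIntegrable_iff_integrableOn_Ioc_of_le hT0.le).1
      ((intervalIntegrable_inv_sqrt_abs_sub 0 T ℓ).const_mul _))
  · filter_upwards [hne] with s ⟨hs, hsℓ⟩
    have h2 := hkD s (Ioc_subset_Icc_self hs)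
    have h3 := hDne s hs hsℓ
    have h4 : 2 * deficit B σ φ x s ≠ 0 := by
      intro h
      have : deficit B σ φ x s = 0 := by linarith
      rw [this, abs_zero] at h2; linarith
    have h5 := ((hφ.hasFDerivAt_deficit hU hB hB0 hx.1 (Ioc_subset_Icc_self hs)).const_mul
      2).sqrt h4
    convert! h5 using 1
    unfold actionDerivIntegrand
    rw [smul_smul]
    congr 1
    rw [one_div, mul_inv]
    ring

/-- The separatrix action is differentiable along `Σ⁻`; its derivative on tangent vectors. -/
theorem IsControlledFlow.hasFDerivWithinAt_sepAction (hU : IsOpen U) (hB : ContDiffOn ℝ 2 B U)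
    (hB0 : ∀ x ∈ U, B x ≠ 0) (hσ : |σ| = 1) (hx : x ∈ SigmaMinus B U)
    (hs : IsSegment B U σ x γ ℓ) (hφ : IsControlledFlow B U σ x γ ℓ T C c s₀ s₁ φ Φ) :
    ∃ dj : Space →L[ℝ] ℝ, HasFDerivWithinAt (sepAction B U σ) dj (SigmaMinus B U) x ∧
      ∀ v ∈ tangentPlane B x,
        IntervalIntegrable (fun s => (parSpeed B (fieldStrength B x) (γ s))⁻¹ *
          (fderiv ℝ (fieldStrength B) x v - fderiv ℝ (fieldStrength B) (γ s) (Φ s v)))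
          volume 0 ℓ ∧
        dj v = ∫ s in (0 : ℝ)..ℓ, (parSpeed B (fieldStrength B x) (γ s))⁻¹ *
          (fderiv ℝ (fieldStrength B) x v - fderiv ℝ (fieldStrength B) (γ s) (Φ s v)) := by
  obtain ⟨hi, hd⟩ := hφ.hasFDerivAt_integral hU hB hB0 hσ hx hs
  have hℓ := hs.length_pos
  have hT := hφ.lt_T
  refine ⟨_, hd.hasFDerivWithinAt.congr_of_eventuallyEq ?_ ?_, fun v hv => ?_⟩
  · exact eventually_nhdsWithin_iff.2 (hφ.sepAction_eventuallyEq hU hB hB0 hσ hx hs)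
  · exact (hφ.sepAction_eventuallyEq hU hB hB0 hσ hx hs).self_of_nhds hx
  · have hv0 : fderiv ℝ (strengthDeriv B) x v = 0 := hv
    have hiv : IntervalIntegrable (fun s => actionDerivIntegrand B σ x φ Φ s v) volume 0 T :=
      ⟨(ContinuousLinearMap.apply ℝ ℝ v).integrable_comp hi.1,
        (ContinuousLinearMap.apply ℝ ℝ v).integrable_comp hi.2⟩
    -- The correction term of the deficit drops out because `d(|B|')` vanishes on tangent vectors.
    have e : EqOn (fun s => actionDerivIntegrand B σ x φ Φ s v)
        (fun s => (parSpeed B (fieldStrength B x) (γ s))⁻¹ *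
          (fderiv ℝ (fieldStrength B) x v - fderiv ℝ (fieldStrength B) (γ s) (Φ s v)))
        (Icc 0 ℓ) := fun s hs' => by
      simp [actionDerivIntegrand, deficitDeriv, hv0, parSpeed,
        deficit_of_strengthDeriv_eq_zero hx.2.1, hφ.eqOn hs']
    have hI0 : uIcc 0 ℓ ⊆ uIcc 0 T := by
      rw [uIcc_of_le hℓ.le, uIcc_of_le (hℓ.trans hT).le]; exact Icc_subset_Icc_right hT.le
    have hI1 : uIcc ℓ T ⊆ uIcc 0 T := by
      rw [uIcc_of_le hT.le, uIcc_of_le (hℓ.trans hT).le]; exact Icc_subset_Icc_left hℓ.le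
    have i0 := hiv.mono_set hI0
    refine ⟨i0.congr fun s hs' => e ?_, ?_⟩
    · rw [uIoc_of_le hℓ.le] at hs'; exact Ioc_subset_Icc_self hs'
    rw [ContinuousLinearMap.intervalIntegral_apply hi,
      ← intervalIntegral.integral_add_adjacent_intervals i0 (hiv.mono_set hI1)]
    -- Past the bounce the root is 0, and so is its inverse, by the convention `0⁻¹ = 0`.
    have e2 : ∫ s in ℓ..T, actionDerivIntegrand B σ x φ Φ s v = 0 := by
      rw [intervalIntegral.integral_congr (g := fun _ => (0 : ℝ)) fun s hs' => ?_]
      · simp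
      · rw [uIcc_of_le hT.le] at hs'
        have h3 := deficit_sub_le_of_le_strengthDeriv hU hB hB0 hx.2.1
          (fun t ht => ⟨(hφ.field.self_of_nhds t
            ⟨by linarith [ht.1, hφ.s₀_pos, hφ.s₀_lt], ht.2⟩).1,
            (hφ.field.self_of_nhds t ⟨by linarith [ht.1, hφ.s₀_pos, hφ.s₀_lt], ht.2⟩).2.mono
            (Icc_subset_Icc_left (by linarith [hφ.s₀_pos, hφ.s₀_lt]))⟩)
          hφ.le_strengthDeriv.self_of_nhds ⟨hφ.s₁_lt.le, hT.le⟩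
          ⟨by linarith [hs'.1, hφ.s₁_lt], hs'.2⟩ hs'.1
        rw [hφ.deficit_end hx.2.1 hs] at h3
        have h4 : deficit B σ φ x s ≤ 0 := by nlinarith [hφ.c_pos, hs'.1]
        simp [actionDerivIntegrand, Real.sqrt_eq_zero_of_nonpos (by linarith :
          2 * deficit B σ φ x s ≤ 0)]
    rw [e2, add_zero]
    refine intervalIntegral.integral_congr fun s hs' => e ?_
    rwa [uIcc_of_le hℓ.le] at hs'

end Action

/-! ### Vector algebra and calculus in coordinates -/

section Coordinates

/-- The standard basis vectors. -/
def basisVec (i : Fin 3) : Space := EuclideanSpace.single i 1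

theorem sum_smul_basisVec (v : Space) :
    v = v 0 • basisVec 0 + v 1 • basisVec 1 + v 2 • basisVec 2 := by
  ext i
  fin_cases i <;> simp [basisVec]

theorem clm_apply_eq {F : Type*} [NormedAddCommGroup F] [NormedSpace ℝ F] (p : Space →L[ℝ] F)
    (v : Space) :
    p v = v 0 • p (basisVec 0) + v 1 • p (basisVec 1) + v 2 • p (basisVec 2) := by
  conv_lhs => rw [sum_smul_basisVec v]
  simp only [map_add, map_smul]

theorem covector_apply_eq (p : Space →L[ℝ] ℝ) (v : Space) :
    p v = v 0 * p (basisVec 0) + v 1 * p (basisVec 1) + v 2 * p (basisVec 2) :=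
  clm_apply_eq p v

theorem inner_eq (v w : Space) : (inner ℝ v w : ℝ) = v 0 * w 0 + v 1 * w 1 + v 2 * w 2 := by
  simp [PiLp.inner_apply, Fin.sum_univ_three, mul_comm]

theorem cross_zero (v w : Space) : cross v w 0 = v 1 * w 2 - v 2 * w 1 := by
  simp [cross, cross_apply]

theorem cross_one (v w : Space) : cross v w 1 = v 2 * w 0 - v 0 * w 2 := by
  simp [cross, cross_apply]

theorem cross_two (v w : Space) : cross v w 2 = v 0 * w 1 - v 1 * w 0 := by
  simp [cross, cross_apply]

theorem fderiv_apply_eq (F : Space → Space) (x v : Space) (i : Fin 3) :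
    fderiv ℝ F x v i =
      v 0 * partialD F 0 i x + v 1 * partialD F 1 i x + v 2 * partialD F 2 i x := by
  rw [clm_apply_eq (fderiv ℝ F x) v]
  simp [partialD, basisVec]

theorem gradient_apply_eq (g : Space → ℝ) (x : Space) (i : Fin 3) :
    gradient g x i = fderiv ℝ g x (basisVec i) := by
  have h : (inner ℝ (gradient g x) (basisVec i) : ℝ) = fderiv ℝ g x (basisVec i) := by
    simp [gradient]
  rw [← h, inner_eq]
  fin_cases i <;> simp [basisVec]

theorem curl_zero (F : Space → Space) (x : Space) :
    curl F x 0 = partialD F 1 2 x - partialD F 2 1 x := rfl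

theorem curl_one (F : Space → Space) (x : Space) :
    curl F x 1 = partialD F 2 0 x - partialD F 0 2 x := rfl

theorem curl_two (F : Space → Space) (x : Space) :
    curl F x 2 = partialD F 0 1 x - partialD F 1 0 x := rfl

theorem partialD_smul {g : Space → ℝ} {F : Space → Space} {x : Space}
    (hg : DifferentiableAt ℝ g x) (hF : DifferentiableAt ℝ F x) (i j : Fin 3) :
    partialD (fun y => g y • F y) i j x =
      g x * partialD F i j x + gradient g x i * F x j := by
  rw [gradient_apply_eq]
  unfold partialD
  have : fderiv ℝ (fun y => g y • F y) x = g x • fderiv ℝ F x + (fderiv ℝ g x).smulRight (F x) :=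
    (hg.hasFDerivAt.smul hF.hasFDerivAt).fderiv
  simp [this, basisVec]

theorem curl_smul {g : Space → ℝ} {F : Space → Space} {x : Space}
    (hg : DifferentiableAt ℝ g x) (hF : DifferentiableAt ℝ F x) :
    curl (fun y => g y • F y) x = g x • curl F x + cross (gradient g x) (F x) := by
  ext i
  fin_cases i
  · simp only [PiLp.add_apply, PiLp.smul_apply, smul_eq_mul, Fin.zero_eta, curl_zero,
      cross_zero, partialD_smul hg hF]; ring
  · simp only [PiLp.add_apply, PiLp.smul_apply, smul_eq_mul, Fin.mk_one, curl_one,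
      cross_one, partialD_smul hg hF]; ring
  · simp only [PiLp.add_apply, PiLp.smul_apply, smul_eq_mul, Fin.reduceFinMk, curl_two,
      cross_two, partialD_smul hg hF]; ring

theorem divergence_smul {g : Space → ℝ} {F : Space → Space} {x : Space}
    (hg : DifferentiableAt ℝ g x) (hF : DifferentiableAt ℝ F x) :
    divergence (fun y => g y • F y) x = g x * divergence F x + fderiv ℝ g x (F x) := by
  rw [covector_apply_eq]
  simp only [divergence, Fin.sum_univ_three, partialD_smul hg hF, gradient_apply_eq]
  ring

/-- The cross product as a continuous bilinear map. -/
def crossL : Space →L[ℝ] Space →L[ℝ] Space :=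
  (LinearMap.mk₂ ℝ cross
    (fun _ _ _ => by simp [cross]) (fun _ _ _ => by simp [cross])
    (fun _ _ _ => by simp [cross]) (fun _ _ _ => by simp [cross])).toContinuousBilinearMap

theorem crossL_apply (v w : Space) : crossL v w = cross v w := rfl

theorem cross_eq_neg (v w : Space) : cross v w = -cross w v := by
  ext i
  fin_cases i
  · simp [cross_zero]; ring
  · simp [cross_one]; ring
  · simp [cross_two]; ring

end Coordinates

/-! ### Pointwise identities for the unit field, the drift and `curl(|u| b)`. -/

section FieldAlgebra

variable {B : Space → Space} {U : Set Space} {y : Space}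

theorem fieldStrength_smul_unitField (hB0 : ∀ x ∈ U, B x ≠ 0) (hy : y ∈ U) :
    fieldStrength B y • unitField B y = B y := by
  rw [unitField, smul_smul, mul_inv_cancel₀ (fieldStrength_pos hB0 hy).ne', one_smul]

theorem inner_unitField_self (hB0 : ∀ x ∈ U, B x ≠ 0) (hy : y ∈ U) :
    (inner ℝ (unitField B y) (unitField B y) : ℝ) = 1 := by
  rw [real_inner_self_eq_norm_sq, unitField, norm_smul, norm_inv, fieldStrength, norm_norm,
    inv_mul_cancel₀ (norm_ne_zero_iff.2 (hB0 y hy)), one_pow]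

/-- Differentiate `b · b = 1`. -/
theorem inner_unitField_fderiv (hU : IsOpen U) (hB : ContDiffOn ℝ 2 B U)
    (hB0 : ∀ x ∈ U, B x ≠ 0) (hy : y ∈ U) (v : Space) :
    (inner ℝ (unitField B y) (fderiv ℝ (unitField B) y v) : ℝ) = 0 := by
  have h := hasFDerivAt_unitField hU hB hB0 hy
  have h1 := h.inner ℝ h
  have h2 : (fun z => (inner ℝ (unitField B z) (unitField B z) : ℝ)) =ᶠ[𝓝 y] fun _ => 1 := by
    filter_upwards [hU.mem_nhds hy] with z hz using inner_unitField_self hB0 hz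
  have h3 := h1.unique ((hasFDerivAt_const (1 : ℝ) y).congr_of_eventuallyEq h2)
  have h4 := congrArg (fun p => p v) h3
  simp only [ContinuousLinearMap.comp_apply, ContinuousLinearMap.prod_apply,
    fderivInnerCLM_apply, zero_apply] at h4
  rw [real_inner_comm (unitField B y)] at h4
  linarith

/-- The curvature of the fieldlines: `(b · ∇) b = curl b × b`. -/
theorem fderiv_unitField_self (hU : IsOpen U) (hB : ContDiffOn ℝ 2 B U)
    (hB0 : ∀ x ∈ U, B x ≠ 0) (hy : y ∈ U) :
    fderiv ℝ (unitField B) y (unitField B y) = cross (curl (unitField B) y) (unitField B y) := by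
  have h := fun i => inner_unitField_fderiv hU hB hB0 hy (basisVec i)
  simp only [inner_eq, fderiv_apply_eq] at h
  have h0 := h 0
  have h1 := h 1
  have h2 := h 2
  simp [basisVec] at h0 h1 h2
  ext i
  fin_cases i
  · simp only [Fin.zero_eta, fderiv_apply_eq, cross_zero, curl_one, curl_two]
    linear_combination h0
  · simp only [Fin.mk_one, fderiv_apply_eq, cross_one, curl_zero, curl_two]
    linear_combination h1
  · simp only [Fin.reduceFinMk, fderiv_apply_eq, cross_two, curl_zero, curl_one]
    linear_combination h2

/-- Expand `div(|B| b) = 0` by the product rule. -/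
theorem fieldStrength_mul_divergence_unitField (hU : IsOpen U) (hB : ContDiffOn ℝ 2 B U)
    (hB0 : ∀ x ∈ U, B x ≠ 0) (hdiv : ∀ x ∈ U, divergence B x = 0) (hy : y ∈ U) :
    fieldStrength B y * divergence (unitField B) y + strengthDeriv B y = 0 := by
  have h : B =ᶠ[𝓝 y] fun z => fieldStrength B z • unitField B z := by
    filter_upwards [hU.mem_nhds hy] with z hz using (fieldStrength_smul_unitField hB0 hz).symm
  have h1 : divergence B y = divergence (fun z => fieldStrength B z • unitField B z) y := by
    simp only [divergence, partialD, h.fderiv_eq]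
  rw [hdiv y hy, divergence_smul (hasFDerivAt_fieldStrength hU hB hB0 hy).differentiableAt
    (hasFDerivAt_unitField hU hB hB0 hy).differentiableAt] at h1
  exact h1.symm

/-- With `p` read as a vector, the left side is `(p × g) · (v × w)`. Splitting `p × g` into its
parts along and across `b`, and using `b × (p × g) = q(b) p`, which holds as `p(b) = 0`, gives the
two terms. -/
theorem wedge_decomposition (p q : Space →L[ℝ] ℝ) {b v w : Space} {g : Space}
    (hg : ∀ i, g i = q (basisVec i)) (hb : (inner ℝ b b : ℝ) = 1) (hp : p b = 0) :
    p v * q w - p w * q v =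
      (inner ℝ b (cross v w) : ℝ) * p (cross g b) +
        q b * (p v * (inner ℝ b w : ℝ) - p w * (inner ℝ b v : ℝ)) := by
  rw [covector_apply_eq] at hp
  rw [inner_eq] at hb
  simp only [covector_apply_eq p v, covector_apply_eq p w, covector_apply_eq q v,
    covector_apply_eq q w, covector_apply_eq q b, covector_apply_eq p (cross g b), inner_eq,
    cross_zero, cross_one, cross_two, hg]
  generalize p (basisVec 0) = p0 at *
  generalize p (basisVec 1) = p1 at *
  generalize p (basisVec 2) = p2 at *
  generalize q (basisVec 0) = q0 at *
  generalize q (basisVec 1) = q1 at *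
  generalize q (basisVec 2) = q2 at *
  linear_combination
    (-((p1 * q2 - p2 * q1) * (v 1 * w 2 - v 2 * w 1) +
      (p2 * q0 - p0 * q2) * (v 2 * w 0 - v 0 * w 2) +
      (p0 * q1 - p1 * q0) * (v 0 * w 1 - v 1 * w 0))) * hb +
    ((b 1 * q2 - b 2 * q1) * (v 1 * w 2 - v 2 * w 1) +
      (b 2 * q0 - b 0 * q2) * (v 2 * w 0 - v 0 * w 2) +
      (b 0 * q1 - b 1 * q0) * (v 0 * w 1 - v 1 * w 0)) * hp

/-- The triple product `p × (c × b) = p(b) c - p(c) b`, paired with `v × w`, with `p(b) = 0`. -/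
theorem covector_curl_decomposition (p : Space →L[ℝ] ℝ) {b c v w : Space} (hp : p b = 0) :
    p c * (inner ℝ b (cross v w) : ℝ) =
      -(p v * (inner ℝ (cross c b) w : ℝ) - p w * (inner ℝ (cross c b) v : ℝ)) := by
  rw [covector_apply_eq] at hp
  simp only [covector_apply_eq p v, covector_apply_eq p w,
    covector_apply_eq p c, inner_eq, cross_zero, cross_one, cross_two]
  generalize p (basisVec 0) = p0 at *
  generalize p (basisVec 1) = p1 at *
  generalize p (basisVec 2) = p2 at *
  linear_combination (c 0 * (v 1 * w 2 - v 2 * w 1) + c 1 * (v 2 * w 0 - v 0 * w 2) +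
    c 2 * (v 0 * w 1 - v 1 * w 0)) * hp

/-- The derivative of a determinant under a linear map applied to each column in turn is the trace
times the determinant. -/
theorem inner_cross_trace (F : Space → Space) (x u v w : Space) :
    (inner ℝ (fderiv ℝ F x u) (cross v w) : ℝ) + inner ℝ u (cross (fderiv ℝ F x v) w) +
      inner ℝ u (cross v (fderiv ℝ F x w)) = divergence F x * inner ℝ u (cross v w) := by
  simp only [inner_eq, cross_zero, cross_one, cross_two, fderiv_apply_eq, divergence,
    Fin.sum_univ_three]
  ring

theorem hasDerivAt_guidingVelocity (hB0 : ∀ x ∈ U, B x ≠ 0) (hy : y ∈ U) (u : ℝ) :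
    HasDerivAt (fun ε => guidingVelocity B ε u y)
      ((fieldStrength B y)⁻¹ • (u ^ 2 • curl (unitField B) y +
        cross (unitField B y) (gradient (fieldStrength B) y)) -
        (u ^ 2 * (fieldStrength B y)⁻¹ * (inner ℝ (curl (unitField B) y) (unitField B y) : ℝ)) •
          unitField B y) 0 := by
  have hpos := fieldStrength_pos hB0 hy
  set h := fieldStrength B y
  set b := unitField B y
  set c := curl (unitField B) y
  set d := cross b (gradient (fieldStrength B) y)
  have hBb : B y = h • b := (fieldStrength_smul_unitField hB0 hy).symm
  have hden : ∀ ε : ℝ, (inner ℝ (B y + (ε * u) • c) b : ℝ) = h + ε * (u * inner ℝ c b) := by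
    intro ε
    rw [hBb, inner_add_left, real_inner_smul_left, real_inner_smul_left,
      inner_unitField_self hB0 hy]
    ring
  have h1 : HasDerivAt (fun ε : ℝ => h + ε * (u * inner ℝ c b)) (u * inner ℝ c b) 0 := by
    simpa using ((hasDerivAt_id (0 : ℝ)).mul_const (u * (inner ℝ c b : ℝ))).const_add h
  have h2 : HasDerivAt (fun ε : ℝ => u • (B y + (ε * u) • c) + ε • d) (u • (u • c) + d) 0 := by
    have e1 : HasDerivAt (fun ε : ℝ => B y + (ε * u) • c) (u • c) 0 := by
      simpa using (((hasDerivAt_id (0 : ℝ)).mul_const u).smul_const c).const_add (B y)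
    have e2 : HasDerivAt (fun ε : ℝ => ε • d) d 0 := by
      simpa using (hasDerivAt_id (0 : ℝ)).smul_const d
    exact (e1.const_smul u).add e2
  have h3 := (h1.inv (by simpa using hpos.ne')).smul h2
  have e : (fun ε => guidingVelocity B ε u y) =
      fun ε => (h + ε * (u * inner ℝ c b))⁻¹ • (u • (B y + (ε * u) • c) + ε • d) := by
    funext ε
    unfold guidingVelocity
    rw [hden]
  rw [e]
  convert! h3 using 1
  rw [hBb]
  simp only [zero_mul, add_zero, zero_smul, Pi.inv_apply]
  rw [sub_eq_add_neg, ← neg_smul, smul_smul, smul_smul, smul_smul, pow_two]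
  congr 2
  field_simp

theorem firstOrderDrift_eq (hB0 : ∀ x ∈ U, B x ≠ 0) (hy : y ∈ U) (u : ℝ) :
    firstOrderDrift B u y =
      (fieldStrength B y)⁻¹ • (u ^ 2 • curl (unitField B) y +
        cross (unitField B y) (gradient (fieldStrength B) y)) -
        (u ^ 2 * (fieldStrength B y)⁻¹ * (inner ℝ (curl (unitField B) y) (unitField B y) : ℝ)) •
          unitField B y := (hasDerivAt_guidingVelocity hB0 hy u).deriv

theorem hasFDerivAt_parSpeed (hU : IsOpen U) (hB : ContDiffOn ℝ 2 B U)
    (hB0 : ∀ x ∈ U, B x ≠ 0) (hy : y ∈ U) {h : ℝ} (hlt : fieldStrength B y < h) :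
    HasFDerivAt (parSpeed B h) (-(parSpeed B h y)⁻¹ • fderiv ℝ (fieldStrength B) y) y := by
  have h1 := (((hasFDerivAt_fieldStrength hU hB hB0 hy).const_sub h).const_mul 2).sqrt
    (by linarith)
  convert! h1 using 1
  rw [smul_smul, smul_neg, neg_smul]
  congr 2
  unfold parSpeed
  rw [one_div, mul_inv]
  ring

/-- Product rule with `∇|u| = -|u|⁻¹ ∇|B|`. The strict inequality keeps away from the singularity of
the root. -/
theorem curl_parSpeed_smul (hU : IsOpen U) (hB : ContDiffOn ℝ 2 B U)
    (hB0 : ∀ x ∈ U, B x ≠ 0) (hy : y ∈ U) {h : ℝ} (hlt : fieldStrength B y < h) :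
    curl (fun z => parSpeed B h z • unitField B z) y =
      parSpeed B h y • curl (unitField B) y +
        (parSpeed B h y)⁻¹ • cross (unitField B y) (gradient (fieldStrength B) y) := by
  have h1 := hasFDerivAt_parSpeed hU hB hB0 hy hlt
  have hg : gradient (parSpeed B h) y =
      -(parSpeed B h y)⁻¹ • gradient (fieldStrength B) y := by
    ext i
    rw [gradient_apply_eq, h1.fderiv]
    simp [gradient_apply_eq]
  rw [curl_smul h1.differentiableAt (hasFDerivAt_unitField hU hB hB0 hy).differentiableAt, hg,
    cross_eq_neg, ← crossL_apply, ← crossL_apply, map_smul, neg_smul, neg_neg]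

end FieldAlgebra

/-! ### Transport of covectors, vectors and flux along the segment. -/

section Transport

variable {B : Space → Space} {U : Set Space} {σ : ℝ} {x : Space} {γ : ℝ → Space} {ℓ : ℝ}

theorem IsSegment.continuousOn (hs : IsSegment B U σ x γ ℓ) : ContinuousOn γ (Icc 0 ℓ) :=
  fun s h => (hs.fieldline s h).continuousWithinAt

theorem IsSegment.exists_isLabelCovector (hU : IsOpen U) (hB : ContDiffOn ℝ 2 B U)
    (hB0 : ∀ x ∈ U, B x ≠ 0) (hs : IsSegment B U σ x γ ℓ) (a₀ : Space →L[ℝ] ℝ) :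
    ∃ a, IsLabelCovector B σ γ ℓ a₀ a := by
  have hc : ContinuousOn (fun s => fderiv ℝ (unitField B) (γ s)) (Icc 0 ℓ) :=
    ((contDiffOn_unitField hB hB0).continuousOn_fderiv_of_isOpen hU (by norm_num)).comp
      hs.continuousOn hs.mem
  obtain ⟨a, h0, h⟩ := exists_linear_ode
    (A := fun s => -(σ • (ContinuousLinearMap.compL ℝ Space Space ℝ).flip
      (fderiv ℝ (unitField B) (γ s)))) hs.length_pos.le
    (((((ContinuousLinearMap.compL ℝ Space Space ℝ).flip).continuous.comp_continuousOn
      hc).const_smul σ).neg) a₀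
  exact ⟨a, h0, fun s hs' => by simpa using h s hs'⟩

theorem isLabelCovector_hCovector (hU : IsOpen U) (hB : ContDiffOn ℝ 2 B U)
    (hB0 : ∀ x ∈ U, B x ≠ 0)
    (hs : IsSegment B U σ x (segCurve B U σ x) (segLength B U σ x)) :
    IsLabelCovector B σ (segCurve B U σ x) (segLength B U σ x)
      (fderiv ℝ (fieldStrength B) x) (hCovector B U σ x) := by
  have H := hs.exists_isLabelCovector hU hB hB0 (fderiv ℝ (fieldStrength B) x)
  unfold hCovector
  rw [dif_pos H]
  exact H.choose_spec

/-- `ξ` is transported by the linearised flow along `γ`. -/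
def IsTransported (B : Space → Space) (σ : ℝ) (γ : ℝ → Space) (ℓ : ℝ) (ξ : ℝ → Space) : Prop :=
  ∀ s ∈ Icc 0 ℓ, HasDerivWithinAt ξ (σ • fderiv ℝ (unitField B) (γ s) (ξ s)) (Icc 0 ℓ) s

theorem eq_apply_zero_of_hasDerivWithinAt_zero {g : ℝ → ℝ} {s : ℝ}
    (hg : ∀ t ∈ Icc 0 ℓ, HasDerivWithinAt g 0 (Icc 0 ℓ) t) (hs : s ∈ Icc 0 ℓ) : g s = g 0 :=
  constant_of_has_deriv_right_zero (fun t ht => (hg t ht).continuousWithinAt)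
    (fun t ht => hasDerivWithinAt_Ici_of_Icc ht (hg t (Ico_subset_Icc_self ht))) s hs

/-- The adjoint and variational equations are dual, so the two terms in the derivative of the
pairing cancel. -/
theorem IsLabelCovector.apply_eq {a₀ : Space →L[ℝ] ℝ} {a : ℝ → Space →L[ℝ] ℝ}
    (ha : IsLabelCovector B σ γ ℓ a₀ a) {ξ : ℝ → Space} (hξ : IsTransported B σ γ ℓ ξ) {s : ℝ}
    (hs : s ∈ Icc 0 ℓ) : a s (ξ s) = a₀ (ξ 0) := by
  rw [← ha.start]
  refine eq_apply_zero_of_hasDerivWithinAt_zero (g := fun s => a s (ξ s)) (fun t ht => ?_) hs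
  have h := (ha.adjoint t ht).clm_apply (hξ t ht)
  convert! h using 1
  simp

theorem IsSegment.isTransported_unitField (hU : IsOpen U) (hB : ContDiffOn ℝ 2 B U)
    (hB0 : ∀ x ∈ U, B x ≠ 0) (hs : IsSegment B U σ x γ ℓ) :
    IsTransported B σ γ ℓ (fun s => unitField B (γ s)) := fun s h => by
  have h1 := (hasFDerivAt_unitField hU hB hB0 (hs.mem s h)).comp_hasDerivWithinAt s
    (hs.fieldline s h)
  rw [map_smul] at h1
  exact h1

/-- The pairing is constant, and its initial value is `|B|'(x) = 0`. -/
theorem IsLabelCovector.apply_unitField (hU : IsOpen U) (hB : ContDiffOn ℝ 2 B U)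
    (hB0 : ∀ x ∈ U, B x ≠ 0) (hs : IsSegment B U σ x γ ℓ) (hx : strengthDeriv B x = 0)
    {a : ℝ → Space →L[ℝ] ℝ} (ha : IsLabelCovector B σ γ ℓ (fderiv ℝ (fieldStrength B) x) a) {s : ℝ}
    (h : s ∈ Icc 0 ℓ) : a s (unitField B (γ s)) = 0 := by
  rw [ha.apply_eq (hs.isTransported_unitField hU hB hB0) h, hs.start]
  exact hx

/-- The magnetic flux through transported parallelograms is constant along the fieldline. -/
theorem IsSegment.flux_eq (hU : IsOpen U) (hB : ContDiffOn ℝ 2 B U)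
    (hB0 : ∀ x ∈ U, B x ≠ 0) (hdiv : ∀ x ∈ U, divergence B x = 0) (hs : IsSegment B U σ x γ ℓ)
    {ξ ζ : ℝ → Space} (hξ : IsTransported B σ γ ℓ ξ) (hζ : IsTransported B σ γ ℓ ζ) {s : ℝ}
    (h : s ∈ Icc 0 ℓ) :
    fieldStrength B (γ s) * (inner ℝ (unitField B (γ s)) (cross (ξ s) (ζ s)) : ℝ) =
      fluxForm B x (ξ 0) (ζ 0) := by
  have h0 : fluxForm B x (ξ 0) (ζ 0) =
      fieldStrength B (γ 0) * (inner ℝ (unitField B (γ 0)) (cross (ξ 0) (ζ 0)) : ℝ) := by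
    rw [← real_inner_smul_left, fieldStrength_smul_unitField hB0
      (hs.mem 0 ⟨le_rfl, hs.length_pos.le⟩), hs.start, fluxForm]
  rw [h0]
  refine eq_apply_zero_of_hasDerivWithinAt_zero (g := fun s => fieldStrength B (γ s) *
    (inner ℝ (unitField B (γ s)) (cross (ξ s) (ζ s)) : ℝ)) (fun t ht => ?_) h
  have h1 := hasDerivWithinAt_fieldStrength_comp hU hB hB0 (hs.mem t ht) (hs.fieldline t ht)
  have h2 : HasDerivWithinAt (fun s => cross (ξ s) (ζ s)) _ (Icc 0 ℓ) t :=
    crossL.hasDerivWithinAt_of_bilinear (hξ t ht) (hζ t ht)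
  have h3 := h1.mul ((hs.isTransported_unitField hU hB hB0 t ht).inner ℝ h2)
  convert! h3 using 1
  -- The linearised flow expands the triple product at the rate `σ div b`, and `|B| div b = -|B|'`
  -- cancels the growth of the factor `|B|`.
  have h4 := inner_cross_trace (unitField B) (γ t) (unitField B (γ t)) (ξ t) (ζ t)
  have h5 := fieldStrength_mul_divergence_unitField hU hB hB0 hdiv (hs.mem t ht)
  simp only [map_smul, crossL_apply, inner_add_right, real_inner_smul_left, real_inner_smul_right,
    smul_apply] at h4 ⊢
  linear_combination (-σ * (inner ℝ (unitField B (γ t)) (cross (ξ t) (ζ t)) : ℝ)) * h5 -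
    (fieldStrength B (γ t) * σ) * h4

end Transport

/-! ### Convergence of the Melnikov integral and its relation to the splitting. -/

section Melnikov

variable {B : Space → Space} {U : Set Space} {σ : ℝ} {x : Space} {γ : ℝ → Space} {ℓ : ℝ}

theorem IsSegment.exists_le_drop (hU : IsOpen U) (hB : ContDiffOn ℝ 2 B U)
    (hB0 : ∀ x ∈ U, B x ≠ 0) (hσ : |σ| = 1) (hx : x ∈ SigmaMinus B U)
    (hs : IsSegment B U σ x γ ℓ) (hne : strengthDeriv B (γ ℓ) ≠ 0) :
    ∃ k > 0, ∀ s ∈ Icc 0 ℓ, k * s ^ 2 * |s - ℓ| ≤ fieldStrength B x - fieldStrength B (γ s) := by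
  obtain ⟨T, C, c, s₀, s₁, φ, Φ, hφ⟩ := hs.exists_isControlledFlow hU hB hB0 hσ hx hne
  obtain ⟨k, hk, h⟩ := hφ.exists_le_abs_deficit hU hB hB0 hσ hx hs
  refine ⟨k, hk, fun s hs' => ?_⟩
  have h1 := h s ⟨hs'.1, hs'.2.trans hφ.lt_T.le⟩
  have h3 : 0 ≤ fieldStrength B x - fieldStrength B (γ s) := by
    rcases eq_or_lt_of_le hs'.1 with h0 | h0
    · rw [← h0, hs.start, sub_self]
    rcases eq_or_lt_of_le hs'.2 with h2 | h2
    · rw [h2, hs.bounce, sub_self]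
    · exact sub_nonneg.2 (hs.below s ⟨h0, h2⟩).le
  rwa [deficit_of_strengthDeriv_eq_zero hx.2.1, hφ.eqOn hs', abs_of_nonneg h3] at h1

theorem IsSegment.parSpeed_pos (hs : IsSegment B U σ x γ ℓ) {s : ℝ} (h : s ∈ Ioo 0 ℓ) :
    0 < parSpeed B (fieldStrength B x) (γ s) :=
  Real.sqrt_pos.2 (by linarith [hs.below s h])

theorem IsSegment.continuousOn_parSpeed (hB : ContDiffOn ℝ 2 B U)
    (hB0 : ∀ x ∈ U, B x ≠ 0) (hs : IsSegment B U σ x γ ℓ) :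
    ContinuousOn (fun s => parSpeed B (fieldStrength B x) (γ s)) (Icc 0 ℓ) :=
  (continuousOn_const.mul (continuousOn_const.sub
    ((contDiffOn_fieldStrength hB hB0).continuousOn.comp hs.continuousOn hs.mem))).sqrt

/-- Differentiability gives the linear bound near 0; elsewhere `s` is bounded below and compactness
suffices. -/
theorem exists_abs_le_mul_of_differentiableWithinAt {g : ℝ → ℝ} (hℓ : 0 < ℓ)
    (hc : ContinuousOn g (Icc 0 ℓ)) (h0 : g 0 = 0)
    (hd : DifferentiableWithinAt ℝ g (Icc 0 ℓ) 0) :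
    ∃ C, 0 ≤ C ∧ ∀ s ∈ Icc 0 ℓ, |g s| ≤ C * s := by
  obtain ⟨M, hM⟩ := isCompact_Icc.exists_bound_of_continuousOn hc
  obtain ⟨c, hcb⟩ := hd.isBigO_sub.bound
  obtain ⟨ε, hε, hεb⟩ := Metric.mem_nhdsWithin_iff.1 hcb
  have hM0 : 0 ≤ M := (norm_nonneg _).trans (hM 0 ⟨le_rfl, hℓ.le⟩)
  refine ⟨max |c| (M / ε), le_max_of_le_left (abs_nonneg _), fun s hs => ?_⟩
  rcases lt_or_ge s ε with h | h
  · have h1 : ‖g s - g 0‖ ≤ c * ‖s - 0‖ := hεb ⟨by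
      rw [Metric.mem_ball, Real.dist_eq, sub_zero, abs_of_nonneg hs.1]; exact h, hs⟩
    rw [h0, sub_zero, sub_zero, Real.norm_eq_abs, Real.norm_eq_abs, abs_of_nonneg hs.1] at h1
    exact h1.trans (mul_le_mul_of_nonneg_right ((le_abs_self c).trans (le_max_left _ _)) hs.1)
  · calc |g s| ≤ M := hM s hs
      _ = M / ε * ε := by field_simp
      _ ≤ max |c| (M / ε) * s := by gcongr; exact le_max_right _ _

/-- Functions that vanish at the start may be divided by `|u|`. -/
theorem IsSegment.intervalIntegrable_inv_parSpeed_mul (hB : ContDiffOn ℝ 2 B U)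
    (hB0 : ∀ x ∈ U, B x ≠ 0) (hs : IsSegment B U σ x γ ℓ)
    (hk : ∃ k > 0, ∀ s ∈ Icc 0 ℓ,
      k * s ^ 2 * |s - ℓ| ≤ fieldStrength B x - fieldStrength B (γ s))
    {g : ℝ → ℝ} (hc : ContinuousOn g (Icc 0 ℓ)) (h0 : g 0 = 0)
    (hd : DifferentiableWithinAt ℝ g (Icc 0 ℓ) 0) :
    IntervalIntegrable (fun s => (parSpeed B (fieldStrength B x) (γ s))⁻¹ * g s) volume 0 ℓ := by
  obtain ⟨k, hk, hkb⟩ := hk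
  have hℓ := hs.length_pos
  obtain ⟨C, hC, hCb⟩ := exists_abs_le_mul_of_differentiableWithinAt hℓ hc h0 hd
  refine ((intervalIntegrable_inv_sqrt_abs_sub 0 ℓ ℓ).const_mul (C / √(2 * k))).mono_fun' ?_ ?_
  · rw [uIoc_of_le hℓ.le]
    refine AEStronglyMeasurable.mul ?_ ?_
    · exact (((hs.continuousOn_parSpeed hB hB0).mono
        Ioc_subset_Icc_self).aestronglyMeasurable measurableSet_Ioc).aemeasurable.inv
        |>.aestronglyMeasurable
    · exact (hc.mono Ioc_subset_Icc_self).aestronglyMeasurable measurableSet_Ioc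
  · rw [uIoc_of_le hℓ.le]
    filter_upwards [ae_restrict_mem measurableSet_Ioc] with s hs'
    have hs0 := hs'.1
    rcases eq_or_lt_of_le hs'.2 with rfl | hlt
    -- At the bounce both sides are 0, again because `0⁻¹ = 0`.
    · simp [parSpeed, hs.bounce]
    have h1 : 0 < |s - ℓ| := abs_pos.2 (by linarith)
    have h2 : √(2 * k) * s * √|s - ℓ| ≤ parSpeed B (fieldStrength B x) (γ s) := by
      have : √(2 * k) * s * √|s - ℓ| = √(2 * (k * s ^ 2 * |s - ℓ|)) := by
        rw [show 2 * (k * s ^ 2 * |s - ℓ|) = (2 * k) * s ^ 2 * |s - ℓ| by ring,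
          Real.sqrt_mul (x := 2 * k * s ^ 2) (by positivity),
          Real.sqrt_mul (x := 2 * k) (by positivity) (s ^ 2), Real.sqrt_sq hs0.le]
      rw [this]
      exact Real.sqrt_le_sqrt (by linarith [hkb s (Ioc_subset_Icc_self hs')])
    have h3 : 0 < √|s - ℓ| := Real.sqrt_pos.2 h1
    have h4 : 0 < √(2 * k) := Real.sqrt_pos.2 (by positivity)
    have h5 := hs.parSpeed_pos ⟨hs0, hlt⟩
    rw [norm_mul, norm_inv, Real.norm_eq_abs, Real.norm_eq_abs, abs_of_pos h5]
    calc (parSpeed B (fieldStrength B x) (γ s))⁻¹ * |g s|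
        ≤ (√(2 * k) * s * √|s - ℓ|)⁻¹ * (C * s) := by
          gcongr
          exact hCb s (Ioc_subset_Icc_self hs')
      _ = C / √(2 * k) * (√|s - ℓ|)⁻¹ := by field_simp

/-- The Melnikov integrand in terms of the label covector. -/
def reducedIntegrand (B : Space → Space) (x : Space) (γ : ℝ → Space)
    (a : ℝ → Space →L[ℝ] ℝ) (s : ℝ) : ℝ :=
  parSpeed B (fieldStrength B x) (γ s) *
      (a s (curl (unitField B) (γ s)) / fieldStrength B (γ s)) +
    (parSpeed B (fieldStrength B x) (γ s))⁻¹ *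
      (a s (cross (unitField B (γ s)) (gradient (fieldStrength B) (γ s))) / fieldStrength B (γ s))

theorem continuousOn_curl {F : Space → Space} (hU : IsOpen U) (hF : ContDiffOn ℝ 1 F U) :
    ContinuousOn (curl F) U := by
  have h : ∀ i j, ContinuousOn (partialD F i j) U := fun i j => by
    have h1 := (hF.continuousOn_fderiv_of_isOpen hU le_rfl).clm_apply
      (continuousOn_const (c := EuclideanSpace.single i (1 : ℝ)))
    exact (EuclideanSpace.proj (𝕜 := ℝ) j).continuous.comp_continuousOn h1
  refine (PiLp.continuous_toLp 2 _).comp_continuousOn (continuousOn_pi.2 fun i => ?_)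
  fin_cases i
  · exact (h 1 2).sub (h 2 1)
  · exact (h 2 0).sub (h 0 2)
  · exact (h 0 1).sub (h 1 0)

theorem inner_gradient_eq (g : Space → ℝ) (y v : Space) :
    (inner ℝ (gradient g y) v : ℝ) = fderiv ℝ g y v := by
  simp [gradient]

theorem fderiv_cross_gradient (g : Space → ℝ) (y b : Space) :
    fderiv ℝ g y (cross b (gradient g y)) = 0 := by
  rw [← inner_gradient_eq, inner_eq, cross_zero, cross_one, cross_two]
  ring

theorem contDiffOn_gradient_fieldStrength (hU : IsOpen U) (hB : ContDiffOn ℝ 2 B U)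
    (hB0 : ∀ x ∈ U, B x ≠ 0) : ContDiffOn ℝ 1 (gradient (fieldStrength B)) U :=
  (InnerProductSpace.toDual ℝ Space).symm.toContinuousLinearEquiv.contDiff.comp_contDiffOn
    ((contDiffOn_fieldStrength hB hB0).fderiv_of_isOpen hU (by norm_num))

theorem contDiffOn_cross_gradient (hU : IsOpen U) (hB : ContDiffOn ℝ 2 B U)
    (hB0 : ∀ x ∈ U, B x ≠ 0) :
    ContDiffOn ℝ 1 (fun y => cross (unitField B y) (gradient (fieldStrength B) y)) U :=
  crossL.isBoundedBilinearMap.contDiff.comp_contDiffOn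
    (((contDiffOn_unitField hB hB0).of_le (by norm_num)).prodMk
      (contDiffOn_gradient_fieldStrength hU hB hB0))

/-- Only the term with `|u|⁻¹` is singular. Its numerator vanishes at the start, where `a = d|B|`
annihilates `b × ∇|B|`, and is differentiable there, which cancels the simple zero of `|u|`. -/
theorem IsSegment.intervalIntegrable_reducedIntegrand (hU : IsOpen U) (hB : ContDiffOn ℝ 2 B U)
    (hB0 : ∀ x ∈ U, B x ≠ 0) (hs : IsSegment B U σ x γ ℓ)
    (hk : ∃ k > 0, ∀ s ∈ Icc 0 ℓ,
      k * s ^ 2 * |s - ℓ| ≤ fieldStrength B x - fieldStrength B (γ s))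
    {a : ℝ → Space →L[ℝ] ℝ} (ha : IsLabelCovector B σ γ ℓ (fderiv ℝ (fieldStrength B) x) a) :
    IntervalIntegrable (reducedIntegrand B x γ a) volume 0 ℓ := by
  have hℓ := hs.length_pos
  have h0 : (0 : ℝ) ∈ Icc 0 ℓ := ⟨le_rfl, hℓ.le⟩
  have hac : ContinuousOn a (Icc 0 ℓ) := fun s h => (ha.adjoint s h).continuousWithinAt
  have hfc : ContinuousOn (fun s => fieldStrength B (γ s)) (Icc 0 ℓ) :=
    (contDiffOn_fieldStrength hB hB0).continuousOn.comp hs.continuousOn hs.mem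
  have hf0 : ∀ s ∈ Icc 0 ℓ, fieldStrength B (γ s) ≠ 0 := fun s h =>
    (fieldStrength_pos hB0 (hs.mem s h)).ne'
  have hcr := contDiffOn_cross_gradient hU hB hB0
  refine IntervalIntegrable.add (ContinuousOn.intervalIntegrable ?_)
    (hs.intervalIntegrable_inv_parSpeed_mul hB hB0 hk ?_ ?_ ?_)
  · rw [uIcc_of_le hℓ.le]
    refine (hs.continuousOn_parSpeed hB hB0).mul ((hac.clm_apply ?_).div hfc hf0)
    exact (continuousOn_curl hU ((contDiffOn_unitField hB hB0).of_le (by norm_num))).comp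
      hs.continuousOn hs.mem
  · exact (hac.clm_apply (hcr.continuousOn.comp hs.continuousOn hs.mem)).div hfc hf0
  · rw [ha.start, hs.start, fderiv_cross_gradient, zero_div]
  · have h1 : DifferentiableWithinAt ℝ
        (fun s => cross (unitField B (γ s)) (gradient (fieldStrength B) (γ s))) (Icc 0 ℓ) 0 :=
      ((hcr.contDiffAt (hU.mem_nhds (hs.mem 0 h0))).differentiableAt
        one_ne_zero).comp_differentiableWithinAt (0 : ℝ)
        (hs.fieldline 0 h0).differentiableWithinAt
    have h2 := (ha.adjoint 0 h0).differentiableWithinAt.clm_apply h1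
    have h3 := (hasDerivWithinAt_fieldStrength_comp hU hB hB0 (hs.mem 0 h0)
      (hs.fieldline 0 h0)).differentiableWithinAt
    exact h2.div h3 (hf0 0 h0)

/-- The open interval is enough for integrals, and the formula for the curl is available only there,
where `|B| < h`. -/
theorem eqOn_melnikovIntegrand (hU : IsOpen U) (hB : ContDiffOn ℝ 2 B U)
    (hB0 : ∀ x ∈ U, B x ≠ 0)
    (hs : IsSegment B U σ x (segCurve B U σ x) (segLength B U σ x)) :
    EqOn (reducedIntegrand B x (segCurve B U σ x) (hCovector B U σ x))
      (melnikovIntegrand B U σ x) (Ioo 0 (segLength B U σ x)) := fun s h => by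
  unfold melnikovIntegrand reducedIntegrand
  rw [curl_parSpeed_smul hU hB hB0 (hs.mem s (Ioo_subset_Icc_self h)) (hs.below s h), map_add,
    map_smul, map_smul, smul_eq_mul, smul_eq_mul]
  ring

/-- The component of the drift along `b` is killed by `a`, and the rest depends on `u` through `u² =
|u|²`, so `η` survives only in the time element. The base-point term is zero, since the drift at `u
= 0` is tangent to the levels of `|B|`. -/
theorem eqOn_shiftIntegrand (hU : IsOpen U) (hB : ContDiffOn ℝ 2 B U)
    (hB0 : ∀ x ∈ U, B x ≠ 0) (hσ : |σ| = 1) (hx : x ∈ SigmaMinus B U)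
    (hs : IsSegment B U σ x (segCurve B U σ x) (segLength B U σ x)) {η : ℝ}
    (hη : η = 1 ∨ η = -1) :
    EqOn (fun s => η * reducedIntegrand B x (segCurve B U σ x) (hCovector B U σ x) s)
      (shiftIntegrand B U σ η x) (Ioo 0 (segLength B U σ x)) := fun s h => by
  have ha := isLabelCovector_hCovector hU hB hB0 hs
  have hu := hs.parSpeed_pos h
  have hσ2 : σ ^ 2 = 1 := by rw [← sq_abs, hσ, one_pow]
  have hη2 : η ^ 2 = 1 := by rcases hη with rfl | rfl <;> norm_num
  have hη0 : η ≠ 0 := by rintro rfl; norm_num at hη2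
  have hI := Ioo_subset_Icc_self h
  have hab := ha.apply_unitField hU hB hB0 hs hx.2.1 hI
  have hpos := fieldStrength_pos hB0 (hs.mem s hI)
  simp only [shiftIntegrand, reducedIntegrand]
  rw [firstOrderDrift_eq hB0 (hs.mem s hI), firstOrderDrift_eq hB0 hx.1, ha.start]
  simp only [map_sub, map_smul, map_add, smul_eq_mul, hab, fderiv_cross_gradient, mul_pow, hσ2, hη2]
  field_simp
  rw [hη2]
  ring

/-- The splitting is twice the Melnikov function. -/
theorem firstOrderSplitting_eq (hU : IsOpen U) (hB : ContDiffOn ℝ 2 B U)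
    (hB0 : ∀ x ∈ U, B x ≠ 0) (hσ : |σ| = 1) (hx : x ∈ SigmaMinus B U)
    (hs : IsSegment B U σ x (segCurve B U σ x) (segLength B U σ x)) :
    firstOrderSplitting B U σ x = 2 * melnikov B U σ x := by
  have h1 : ∀ η : ℝ, η = 1 ∨ η = -1 → firstOrderShift B U σ η x = η * melnikov B U σ x := by
    intro η hη
    unfold firstOrderShift melnikov
    rw [← intervalIntegral.integral_congr_Ioo_of_le hs.length_pos.le
      (eqOn_shiftIntegrand hU hB hB0 hσ hx hs hη),
      ← intervalIntegral.integral_congr_Ioo_of_le hs.length_pos.le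
      (eqOn_melnikovIntegrand hU hB hB0 hs), intervalIntegral.integral_const_mul]
  rw [firstOrderSplitting, h1 1 (Or.inl rfl), h1 (-1) (Or.inr rfl)]
  ring

end Melnikov

/-! ### The identity between the two integrands and its integrated form. -/

section Identity

variable {B : Space → Space} {U : Set Space} {σ : ℝ} {x : Space} {γ : ℝ → Space} {ℓ : ℝ}

/-- The integrand of `dh ∧ dȷ` and that of the Melnikov function times the flux differ by a
derivative. -/
theorem IsSegment.integrand_identity (hU : IsOpen U) (hB : ContDiffOn ℝ 2 B U)
    (hB0 : ∀ x ∈ U, B x ≠ 0) (hdiv : ∀ x ∈ U, divergence B x = 0)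
    (hx : strengthDeriv B x = 0) (hs : IsSegment B U σ x γ ℓ) {a : ℝ → Space →L[ℝ] ℝ}
    (ha : IsLabelCovector B σ γ ℓ (fderiv ℝ (fieldStrength B) x) a)
    {ξ ζ : ℝ → Space} (hξ : IsTransported B σ γ ℓ ξ) (hζ : IsTransported B σ γ ℓ ζ) {s : ℝ}
    (h : s ∈ Ioo 0 ℓ) (p q : ℝ) (hp : p = fderiv ℝ (fieldStrength B) x (ξ 0))
    (hq : q = fderiv ℝ (fieldStrength B) x (ζ 0)) :
    p * ((parSpeed B (fieldStrength B x) (γ s))⁻¹ *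
        (q - fderiv ℝ (fieldStrength B) (γ s) (ζ s))) -
      q * ((parSpeed B (fieldStrength B x) (γ s))⁻¹ *
        (p - fderiv ℝ (fieldStrength B) (γ s) (ξ s))) =
    reducedIntegrand B x γ a s * fluxForm B x (ξ 0) (ζ 0) +
      (-((parSpeed B (fieldStrength B x) (γ s))⁻¹ * (strengthDeriv B (γ s) *
        (p * (inner ℝ (unitField B (γ s)) (ζ s) : ℝ) -
          q * (inner ℝ (unitField B (γ s)) (ξ s) : ℝ)))) +
       parSpeed B (fieldStrength B x) (γ s) *
        (p * (inner ℝ (fderiv ℝ (unitField B) (γ s) (unitField B (γ s))) (ζ s) : ℝ) -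
          q * (inner ℝ (fderiv ℝ (unitField B) (γ s) (unitField B (γ s))) (ξ s) : ℝ))) := by
  have hI := Ioo_subset_Icc_self h
  have hy := hs.mem s hI
  have hpos := fieldStrength_pos hB0 hy
  have hab := ha.apply_unitField hU hB hB0 hs hx hI
  have h1 := wedge_decomposition (a s) (fderiv ℝ (fieldStrength B) (γ s)) (v := ξ s) (w := ζ s)
    (fun i => gradient_apply_eq (fieldStrength B) (γ s) i) (inner_unitField_self hB0 hy) hab
  have h2 := covector_curl_decomposition (a s) (c := curl (unitField B) (γ s)) (v := ξ s)
    (w := ζ s) hab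
  rw [cross_eq_neg (gradient _ _), map_neg] at h1
  rw [← fderiv_unitField_self hU hB hB0 hy] at h2
  rw [ha.apply_eq hξ hI, ha.apply_eq hζ hI, ← hp, ← hq] at h1 h2
  rw [← hs.flux_eq hU hB hB0 hdiv hξ hζ hI]
  unfold reducedIntegrand
  have h3 : strengthDeriv B (γ s) = fderiv ℝ (fieldStrength B) (γ s) (unitField B (γ s)) := rfl
  rw [h3]
  have e : ∀ (A F I : ℝ), F ≠ 0 → A / F * (F * I) = A * I := fun A F I hF => by field_simp
  rw [add_mul, mul_assoc, mul_assoc, e _ _ _ hpos.ne', e _ _ _ hpos.ne']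
  -- The decomposition of `a ∧ d|B|` accounts for the `|u|⁻¹` terms and that of `a(c)` for the `|u|`
  -- terms.
  linear_combination (-(parSpeed B (fieldStrength B x) (γ s))⁻¹) * h1 -
    parSpeed B (fieldStrength B x) (γ s) * h2

/-- The identity `dh ∧ dȷ = M_h β`, in integrated form. -/
theorem IsSegment.integral_identity (hU : IsOpen U) (hB : ContDiffOn ℝ 2 B U)
    (hB0 : ∀ x ∈ U, B x ≠ 0) (hdiv : ∀ x ∈ U, divergence B x = 0) (hσ : |σ| = 1)
    (hx : strengthDeriv B x = 0) (hs : IsSegment B U σ x γ ℓ)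
    (hk : ∃ k > 0, ∀ s ∈ Icc 0 ℓ,
      k * s ^ 2 * |s - ℓ| ≤ fieldStrength B x - fieldStrength B (γ s))
    {a : ℝ → Space →L[ℝ] ℝ}
    (ha : IsLabelCovector B σ γ ℓ (fderiv ℝ (fieldStrength B) x) a)
    {ξ ζ : ℝ → Space} (hξ : IsTransported B σ γ ℓ ξ) (hζ : IsTransported B σ γ ℓ ζ)
    (p q : ℝ) (hp : p = fderiv ℝ (fieldStrength B) x (ξ 0))
    (hq : q = fderiv ℝ (fieldStrength B) x (ζ 0))
    (hiξ : IntervalIntegrable (fun s => (parSpeed B (fieldStrength B x) (γ s))⁻¹ *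
        (p - fderiv ℝ (fieldStrength B) (γ s) (ξ s))) volume 0 ℓ)
    (hiζ : IntervalIntegrable (fun s => (parSpeed B (fieldStrength B x) (γ s))⁻¹ *
        (q - fderiv ℝ (fieldStrength B) (γ s) (ζ s))) volume 0 ℓ) :
    p * (∫ s in (0 : ℝ)..ℓ, (parSpeed B (fieldStrength B x) (γ s))⁻¹ *
        (q - fderiv ℝ (fieldStrength B) (γ s) (ζ s))) -
      q * (∫ s in (0 : ℝ)..ℓ, (parSpeed B (fieldStrength B x) (γ s))⁻¹ *
        (p - fderiv ℝ (fieldStrength B) (γ s) (ξ s))) =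
    (∫ s in (0 : ℝ)..ℓ, reducedIntegrand B x γ a s) * fluxForm B x (ξ 0) (ζ 0) := by
  have hℓ := hs.length_pos
  have h0 : (0 : ℝ) ∈ Icc 0 ℓ := ⟨le_rfl, hℓ.le⟩
  have hσ2 : σ * σ = 1 := by rw [← abs_mul_abs_self, hσ, one_mul]
  set P : ℝ → ℝ := fun s => parSpeed B (fieldStrength B x) (γ s) with hP
  set b : ℝ → Space := fun s => unitField B (γ s) with hb
  set W : ℝ → ℝ := fun s => p * (inner ℝ (b s) (ζ s) : ℝ) - q * (inner ℝ (b s) (ξ s) : ℝ) with hW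
  set W' : ℝ → ℝ := fun s => p * (inner ℝ (fderiv ℝ (unitField B) (γ s) (b s)) (ζ s) : ℝ) -
    q * (inner ℝ (fderiv ℝ (unitField B) (γ s) (b s)) (ξ s) : ℝ) with hW'
  set E' : ℝ → ℝ := fun s => -((P s)⁻¹ * (strengthDeriv B (γ s) * W s)) + P s * W' s with hE'
  have hξc : ContinuousOn ξ (Icc 0 ℓ) := fun s h => (hξ s h).continuousWithinAt
  have hζc : ContinuousOn ζ (Icc 0 ℓ) := fun s h => (hζ s h).continuousWithinAt
  have hbt := hs.isTransported_unitField hU hB hB0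
  have hbc : ContinuousOn b (Icc 0 ℓ) := fun s h => (hbt s h).continuousWithinAt
  have hPc : ContinuousOn P (Icc 0 ℓ) := hs.continuousOn_parSpeed hB hB0
  have hWd : ∀ s ∈ Icc 0 ℓ, HasDerivWithinAt W (σ * W' s) (Icc 0 ℓ) s := fun s h => by
    have h1 := (((hbt s h).inner ℝ (hζ s h)).const_mul p).sub
      (((hbt s h).inner ℝ (hξ s h)).const_mul q)
    convert! h1 using 1
    simp only [hW', hb, real_inner_smul_left, real_inner_smul_right,
      inner_unitField_fderiv hU hB hB0 (hs.mem s h)]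
    ring
  have hWc : ContinuousOn W (Icc 0 ℓ) := fun s h => (hWd s h).continuousWithinAt
  have hfd := fun s (h : s ∈ Icc 0 ℓ) =>
    hasDerivWithinAt_strengthDeriv_comp hU hB hB0 (hs.mem s h) (hs.fieldline s h)
  have hfc : ContinuousOn (fun s => strengthDeriv B (γ s)) (Icc 0 ℓ) := fun s h =>
    (hfd s h).continuousWithinAt
  have hDb : ContinuousOn (fun s => fderiv ℝ (unitField B) (γ s) (b s)) (Icc 0 ℓ) :=
    (((contDiffOn_unitField hB hB0).continuousOn_fderiv_of_isOpen hU (by norm_num)).comp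
      hs.continuousOn hs.mem).clm_apply hbc
  have hW'c : ContinuousOn W' (Icc 0 ℓ) :=
    (continuousOn_const.mul (hDb.inner hζc)).sub (continuousOn_const.mul (hDb.inner hξc))
  have hEi : IntervalIntegrable E' volume 0 ℓ := by
    refine IntervalIntegrable.add (IntervalIntegrable.neg
      (hs.intervalIntegrable_inv_parSpeed_mul hB hB0 hk
        (g := fun s => strengthDeriv B (γ s) * W s) (hfc.mul hWc) ?_ ?_)) ?_
    · simp only [hs.start, hx, zero_mul]
    · exact (hfd 0 h0).differentiableWithinAt.mul (hWd 0 h0).differentiableWithinAt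
    · refine ContinuousOn.intervalIntegrable ?_
      rw [uIcc_of_le hℓ.le]
      exact hPc.mul hW'c
  -- `E'` is the derivative of `σ |u| W` on the open interval, and `|u|` vanishes at both ends.
  -- Continuity up to the ends and integrability of `E'` are enough for the fundamental theorem,
  -- though `|u|` need not be differentiable at the bounce.
  have hE : ∫ s in (0 : ℝ)..ℓ, E' s = 0 := by
    have := intervalIntegral.integral_eq_sub_of_hasDerivAt_of_le (f := fun s => σ * (P s * W s))
      hℓ.le (continuousOn_const.mul (hPc.mul hWc)) (f' := E') (fun s h => ?_) hEi
    · rw [this]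
      simp [hP, parSpeed, hs.start, hs.bounce]
    · have hn : Icc 0 ℓ ∈ 𝓝 s := Icc_mem_nhds h.1 h.2
      have hI := Ioo_subset_Icc_self h
      have h1 := (hasFDerivAt_parSpeed hU hB hB0 (hs.mem s hI)
        (hs.below s h)).comp_hasDerivAt s ((hs.fieldline s hI).hasDerivAt hn)
      have h2 := (h1.mul ((hWd s hI).hasDerivAt hn)).const_mul σ
      convert! h2 using 1
      simp only [hE', hP, strengthDeriv, smul_apply, map_smul, smul_eq_mul, Function.comp_apply]
      linear_combination
        ((parSpeed B (fieldStrength B x) (γ s))⁻¹ *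
          (fderiv ℝ (fieldStrength B) (γ s) (unitField B (γ s)) * W s) -
          parSpeed B (fieldStrength B x) (γ s) * W' s) * hσ2
  have hRi := hs.intervalIntegrable_reducedIntegrand hU hB hB0 hk ha
  have hadd := intervalIntegral.integral_add (hRi.mul_const (fluxForm B x (ξ 0) (ζ 0))) hEi
  rw [hE, add_zero] at hadd
  rw [← intervalIntegral.integral_const_mul, ← intervalIntegral.integral_const_mul,
    ← intervalIntegral.integral_sub (hiζ.const_mul p) (hiξ.const_mul q),
    ← intervalIntegral.integral_mul_const, ← hadd]
  exact intervalIntegral.integral_congr_Ioo_of_le hℓ.le fun s h =>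
    hs.integrand_identity hU hB hB0 hdiv hx ha hξ hζ h p q hp hq

end Identity

/-! ### Passage to the tangent plane of `Σ⁻`. -/

section Tangent

variable {B : Space → Space} {U : Set Space} {σ : ℝ} {x : Space}

/-- Derivatives along `Σ⁻` are determined on tangent vectors. -/
theorem hasFDerivWithinAt_unique_tangentPlane (hU : IsOpen U) (hB : ContDiffOn ℝ 2 B U)
    (hB0 : ∀ x ∈ U, B x ≠ 0) (hx : x ∈ SigmaMinus B U) {g : Space → ℝ} {p q : Space →L[ℝ] ℝ}
    (hp : HasFDerivWithinAt g p (SigmaMinus B U) x)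
    (hq : HasFDerivWithinAt g q (SigmaMinus B U) x) {v : Space} (hv : v ∈ tangentPlane B x) :
    p v = q v := by
  set f' := fderiv ℝ (strengthDeriv B) x with hf'
  have hf : HasStrictFDerivAt (strengthDeriv B) f' x :=
    ((contDiffOn_strengthDeriv hU hB hB0).contDiffAt (hU.mem_nhds hx.1)).hasStrictFDerivAt
      one_ne_zero
  have hne : f' (unitField B x) ≠ 0 := hx.2.2.ne
  have hsurj : f'.range = ⊤ := by
    rw [LinearMap.range_eq_top]
    intro t
    refine ⟨(t / f' (unitField B x)) • unitField B x, ?_⟩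
    simp only [ContinuousLinearMap.coe_coe, map_smul, smul_eq_mul]
    field_simp
  -- Because `b` is transverse, the level set is parametrised over its tangent plane with derivative
  -- the inclusion. Both candidates then give the derivative of the single function `g ∘ ψ` at 0.
  set ψ := hf.implicitFunction (strengthDeriv B) f' hsurj (strengthDeriv B x) with hψ
  have hψd : HasFDerivAt ψ f'.ker.subtypeL 0 := (hf.to_implicitFunction hsurj).hasFDerivAt
  have hψ0 : ψ 0 = x := hf.implicitFunction_apply_image hsurj
  have hψc : ContinuousAt ψ 0 := hψd.continuousAt
  have hψS : ∀ᶠ z in 𝓝 (0 : f'.ker), ψ z ∈ SigmaMinus B U := by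
    have h1 : ∀ᶠ z in 𝓝 (0 : f'.ker), strengthDeriv B (ψ z) = strengthDeriv B x := by
      have h2 := hf.map_implicitFunction_eq hsurj
      exact (Continuous.prodMk continuous_const continuous_id).tendsto' (0 : f'.ker)
        (strengthDeriv B x, (0 : f'.ker)) rfl |>.eventually h2
    have h3 : ∀ᶠ y in 𝓝 x, y ∈ U ∧ strengthDeriv2 B y < 0 :=
      Filter.Eventually.and (hU.mem_nhds hx.1)
        (((continuousOn_strengthDeriv2 hU hB hB0).continuousAt
        (hU.mem_nhds hx.1)).eventually_lt continuousAt_const hx.2.2)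
    rw [← hψ0] at h3
    filter_upwards [h1, hψc.eventually h3] with z hz1 hz2
    exact ⟨hz2.1, hz1.trans hx.2.1, hz2.2⟩
  have ht : Filter.Tendsto ψ (𝓝 0) (𝓝[SigmaMinus B U] (ψ 0)) :=
    tendsto_nhdsWithin_iff.2 ⟨hψc, hψS⟩
  have key : ∀ r : Space →L[ℝ] ℝ, HasFDerivWithinAt g r (SigmaMinus B U) x →
      HasFDerivAt (g ∘ ψ) (r.comp f'.ker.subtypeL) 0 := fun r hr => by
    rw [← hψ0] at hr
    rw [← hasFDerivWithinAt_univ]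
    exact HasFDerivWithinAt.comp_of_tendsto (0 : f'.ker) hr hψd.hasFDerivWithinAt
      (by rwa [nhdsWithin_univ])
  have := congrArg (fun r => r ⟨v, hv⟩) ((key p hp).unique (key q hq))
  simpa using this

/-- The flux form does not vanish on planes transverse to the field. -/
theorem exists_fluxForm_ne_zero (hB0 : ∀ x ∈ U, B x ≠ 0) (hx : x ∈ SigmaMinus B U) :
    ∃ v ∈ tangentPlane B x, ∃ w ∈ tangentPlane B x, fluxForm B x v w ≠ 0 := by
  -- The plane is orthogonal to `n`, so it contains every `n × a`, and `(n × a) × (n × b) = (n · (a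
  -- × b)) n`. The flux is therefore a multiple of `B · n = |B| |B|''`, which is nonzero.
  set n := gradient (strengthDeriv B) x with hn
  have hT : ∀ v, (inner ℝ n v : ℝ) = 0 → v ∈ tangentPlane B x := fun v hv => by
    rw [inner_gradient_eq] at hv
    exact hv
  have hBn : (inner ℝ (B x) n : ℝ) ≠ 0 := by
    rw [real_inner_comm, inner_gradient_eq, ← fieldStrength_smul_unitField hB0 hx.1, map_smul]
    exact mul_ne_zero (fieldStrength_pos hB0 hx.1).ne' hx.2.2.ne
  have hmem : ∀ a, cross n a ∈ tangentPlane B x := fun a => hT _ (by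
    rw [inner_eq, cross_zero, cross_one, cross_two]; ring)
  have hflux : ∀ a b, fluxForm B x (cross n a) (cross n b) =
      (inner ℝ (B x) n : ℝ) * inner ℝ n (cross a b) := fun a b => by
    simp only [fluxForm, inner_eq, cross_zero, cross_one, cross_two]; ring
  have hex : ∃ a b, (inner ℝ n (cross a b) : ℝ) ≠ 0 := by
    by_contra! h
    have h0 := h (basisVec 1) (basisVec 2)
    have h1 := h (basisVec 2) (basisVec 0)
    have h2 := h (basisVec 0) (basisVec 1)
    simp [inner_eq, cross_zero, cross_one, cross_two, basisVec] at h0 h1 h2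
    exact hBn (by rw [inner_eq, h0, h1, h2]; ring)
  obtain ⟨a, b, hab⟩ := hex
  exact ⟨_, hmem a, _, hmem b, by rw [hflux]; exact mul_ne_zero hBn hab⟩

/-- Two covectors are dependent on a subspace iff their exterior product vanishes there. -/
theorem not_linearIndependent_iff_wedge (p q : Space →L[ℝ] ℝ) (S : Submodule ℝ Space) :
    ¬ LinearIndependent ℝ ![p.comp S.subtypeL, q.comp S.subtypeL] ↔
      ∀ v ∈ S, ∀ w ∈ S, wedge p q v w = 0 := by
  rw [LinearIndependent.pair_iff]
  constructor
  · intro h v hv w hw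
    push Not at h
    obtain ⟨s, t, hst, hne⟩ := h
    have e : ∀ u ∈ S, s * p u + t * q u = 0 := fun u hu => by
      simpa using congrArg (fun r => r ⟨u, hu⟩) hst
    have ev := e v hv
    have ew := e w hw
    unfold wedge
    by_cases hs : s = 0
    · have ht := hne hs
      subst hs
      have hv0 : q v = 0 := by simpa [ht] using ev
      have hw0 : q w = 0 := by simpa [ht] using ew
      rw [hv0, hw0]; ring
    · have : s * (p v * q w - p w * q v) = 0 := by linear_combination q w * ev - q v * ew
      exact (mul_eq_zero.1 this).resolve_left hs
  · intro h hli
    by_cases hp : ∀ v ∈ S, p v = 0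
    · have := hli 1 0 (by
        ext v
        simpa using hp v v.2)
      exact one_ne_zero this.1
    · push Not at hp
      obtain ⟨v, hv, hpv⟩ := hp
      -- The vanishing of `p(v) q(w) - p(w) q(v)` for all `w` is itself a linear relation,
      -- nontrivial as `p(v) ≠ 0`.
      have := hli (-q v) (p v) (by
        ext w
        have := h v hv w w.2
        unfold wedge at this
        simp only [add_apply, smul_apply, ContinuousLinearMap.comp_apply, Submodule.subtypeL_apply,
          smul_eq_mul, zero_apply]
        linarith)
      exact hpv this.2

/-- The separatrix action is differentiable along `Σ⁻`, with `dh ∧ dȷ = M_h β`. -/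
theorem exists_hasFDerivWithinAt_sepAction (hU : IsOpen U) (hB : ContDiffOn ℝ 2 B U)
    (hB0 : ∀ x ∈ U, B x ≠ 0) (hdiv : ∀ x ∈ U, divergence B x = 0) (hσ : |σ| = 1)
    (hx : x ∈ SigmaMinus B U)
    (hs : IsSegment B U σ x (segCurve B U σ x) (segLength B U σ x))
    (hne : strengthDeriv B (segCurve B U σ x (segLength B U σ x)) ≠ 0) :
    ∃ dj : Space →L[ℝ] ℝ, HasFDerivWithinAt (sepAction B U σ) dj (SigmaMinus B U) x ∧
      ∀ v ∈ tangentPlane B x, ∀ w ∈ tangentPlane B x,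
        wedge (fderiv ℝ (fieldStrength B) x) dj v w = melnikov B U σ x * fluxForm B x v w := by
  obtain ⟨T, C, c, s₀, s₁, φ, Φ, hφ⟩ := hs.exists_isControlledFlow hU hB hB0 hσ hx hne
  obtain ⟨dj, hdj, hv⟩ := hφ.hasFDerivWithinAt_sepAction hU hB hB0 hσ hx hs
  have hI : Icc 0 (segLength B U σ x) ⊆ Icc 0 T := Icc_subset_Icc_right hφ.lt_T.le
  have htr : ∀ v, IsTransported B σ (segCurve B U σ x) (segLength B U σ x) (fun s => Φ s v) :=
    fun v s h => by
      have h1 := ((hφ.var s (hI h)).mono hI).clm_apply (hasDerivWithinAt_const s _ v)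
      rw [hφ.eqOn h] at h1
      simpa using h1
  have hΦ0 : ∀ v, Φ 0 v = v := fun v => by rw [hφ.var_init]; rfl
  refine ⟨dj, hdj, fun v hvT w hwT => ?_⟩
  obtain ⟨hiv, hdv⟩ := hv v hvT
  obtain ⟨hiw, hdw⟩ := hv w hwT
  have key := hs.integral_identity hU hB hB0 hdiv hσ hx.2.1
    (hs.exists_le_drop hU hB hB0 hσ hx hne) (isLabelCovector_hCovector hU hB hB0 hs) (htr v) (htr w)
    (fderiv ℝ (fieldStrength B) x v) (fderiv ℝ (fieldStrength B) x w) (by rw [hΦ0]) (by rw [hΦ0])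
    hiv hiw
  rw [hΦ0, hΦ0, ← hdv, ← hdw, intervalIntegral.integral_congr_Ioo_of_le hs.length_pos.le
    (eqOn_melnikovIntegrand hU hB hB0 hs)] at key
  unfold wedge
  exact key

end Tangent

/-! ### The edge condition: components of `Σ⁰` and of `Σ⁰ × {0}`. -/

theorem connectedComponentIn_prod_singleton_subset {X Y : Type*} [TopologicalSpace X]
    [TopologicalSpace Y] {S : Set X} {c : Y} {z w : X × Y}
    (hw : w ∈ connectedComponentIn (S ×ˢ {c}) z) :
    w.1 ∈ connectedComponentIn S z.1 ∧ w.2 = c ∧ z.2 = c := by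
  have hz : z ∈ S ×ˢ ({c} : Set Y) := by
    by_contra h
    rw [connectedComponentIn_eq_empty h] at hw
    exact hw
  have hpre := (isPreconnected_connectedComponentIn (x := z) (F := S ×ˢ ({c} : Set Y))).image
    Prod.fst continuous_fst.continuousOn
  refine ⟨hpre.subset_connectedComponentIn ⟨z, mem_connectedComponentIn hz, rfl⟩ ?_
    ⟨w, hw, rfl⟩, (connectedComponentIn_subset _ _ hw).2, hz.2⟩
  rintro _ ⟨y, hy, rfl⟩
  exact (connectedComponentIn_subset _ _ hy).1

theorem mk_mem_connectedComponentIn_prod_singleton {X Y : Type*} [TopologicalSpace X]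
    [TopologicalSpace Y] {S : Set X} (c : Y) {x y : X} (hy : y ∈ connectedComponentIn S x) :
    (y, c) ∈ connectedComponentIn (S ×ˢ {c}) (x, c) := by
  have hx : x ∈ S := by
    by_contra h
    rw [connectedComponentIn_eq_empty h] at hy
    exact hy
  have hpre := (isPreconnected_connectedComponentIn (x := x) (F := S)).image
    (fun y => (y, c)) (by fun_prop)
  refine hpre.subset_connectedComponentIn ⟨x, mem_connectedComponentIn hx, rfl⟩ ?_ ⟨y, hy, rfl⟩
  rintro _ ⟨y, hy, rfl⟩
  exact ⟨connectedComponentIn_subset _ _ hy, rfl⟩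

/-- Components correspond under the projection and the section at 0, and the Hamiltonian at `u = 0`
is `|B|`. -/
theorem constOnEdge_iff (B : Space → Space) (U : Set Space) :
    (∀ z, ∀ w ∈ connectedComponentIn (SigmaZero B U ×ˢ ({0} : Set ℝ)) z,
      scaledHamiltonian B w = scaledHamiltonian B z) ↔
    ∀ x, ∀ y ∈ connectedComponentIn (SigmaZero B U) x,
      fieldStrength B y = fieldStrength B x := by
  constructor
  · intro h x y hy
    simpa [scaledHamiltonian] using
      h (x, 0) (y, 0) (mk_mem_connectedComponentIn_prod_singleton 0 hy)
  · intro h z w hw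
    obtain ⟨h1, h2, h3⟩ := connectedComponentIn_prod_singleton_subset hw
    simp [scaledHamiltonian, h2, h3, h _ _ h1]

end GuidingCentre

end

open GuidingCentre
theorem mainTheorem2 (B : Space → Space) (U : Set Space) (hU : IsOpen U)
    (hB : ContDiffOn ℝ 2 B U) (hB0 : ∀ x ∈ U, B x ≠ 0) (hdiv : ∀ x ∈ U, divergence B x = 0) :
    (∀ σ : ℝ, σ = 1 ∨ σ = -1 → ∀ x ∈ SigmaMinusReg B U σ,
      -- the data that define the Melnikov function and the splitting are well defined
      IsSegment B U σ x (segCurve B U σ x) (segLength B U σ x) ∧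
      IsLabelCovector B σ (segCurve B U σ x) (segLength B U σ x)
        (fderiv ℝ (fieldStrength B) x) (hCovector B U σ x) ∧
      IntervalIntegrable (melnikovIntegrand B U σ x) volume 0 (segLength B U σ x) ∧
      (∀ η : ℝ, η = 1 ∨ η = -1 →
        IntervalIntegrable (shiftIntegrand B U σ η x) volume 0 (segLength B U σ x)) ∧
      -- the Melnikov function measures the first-order splitting of the contracting manifolds
      firstOrderSplitting B U σ x = 2 * melnikov B U σ x ∧
      -- `dh ∧ dȷ = M_h β` on the tangent plane
      DifferentiableWithinAt ℝ (sepAction B U σ) (SigmaMinus B U) x ∧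
      (∀ dj : Space →L[ℝ] ℝ, HasFDerivWithinAt (sepAction B U σ) dj (SigmaMinus B U) x →
        ∀ v ∈ tangentPlane B x, ∀ w ∈ tangentPlane B x,
          wedge (fderiv ℝ (fieldStrength B) x) dj v w = melnikov B U σ x * fluxForm B x v w) ∧
      (firstOrderSplitting B U σ x = 0 ↔ DependentAt B U σ x)) ∧
    (FirstOrderStronglyIsodrastic B U ↔ WeakIsodrasticityCondition B U) := by
  have main : ∀ σ : ℝ, σ = 1 ∨ σ = -1 → ∀ x ∈ SigmaMinusReg B U σ,
      IsSegment B U σ x (segCurve B U σ x) (segLength B U σ x) ∧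
      IsLabelCovector B σ (segCurve B U σ x) (segLength B U σ x)
        (fderiv ℝ (fieldStrength B) x) (hCovector B U σ x) ∧
      IntervalIntegrable (melnikovIntegrand B U σ x) volume 0 (segLength B U σ x) ∧
      (∀ η : ℝ, η = 1 ∨ η = -1 →
        IntervalIntegrable (shiftIntegrand B U σ η x) volume 0 (segLength B U σ x)) ∧
      firstOrderSplitting B U σ x = 2 * melnikov B U σ x ∧
      DifferentiableWithinAt ℝ (sepAction B U σ) (SigmaMinus B U) x ∧
      (∀ dj : Space →L[ℝ] ℝ, HasFDerivWithinAt (sepAction B U σ) dj (SigmaMinus B U) x →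
        ∀ v ∈ tangentPlane B x, ∀ w ∈ tangentPlane B x,
          wedge (fderiv ℝ (fieldStrength B) x) dj v w = melnikov B U σ x * fluxForm B x v w) ∧
      (firstOrderSplitting B U σ x = 0 ↔ DependentAt B U σ x) := by
    intro σ hσ' x hxr
    have hσ : |σ| = 1 := by rcases hσ' with rfl | rfl <;> simp
    have hx : x ∈ SigmaMinus B U := hxr.1
    obtain ⟨hs, hne⟩ := isSegment_of_mem_sigmaMinusReg hU hB hB0 hxr
    have ha := isLabelCovector_hCovector hU hB hB0 hs
    have hR := hs.intervalIntegrable_reducedIntegrand hU hB hB0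
      (hs.exists_le_drop hU hB hB0 hσ hx hne) ha
    have huI : uIoo 0 (segLength B U σ x) = Ioo 0 (segLength B U σ x) :=
      uIoo_of_le hs.length_pos.le
    obtain ⟨dj₀, hdj₀, hw₀⟩ := exists_hasFDerivWithinAt_sepAction hU hB hB0 hdiv hσ hx hs hne
    have hsplit := firstOrderSplitting_eq hU hB hB0 hσ hx hs
    -- A derivative within the surface `Σ⁻` is determined as a covector only on the tangent plane,
    -- which is all that the exterior product uses.
    have hwedge : ∀ dj : Space →L[ℝ] ℝ,
        HasFDerivWithinAt (sepAction B U σ) dj (SigmaMinus B U) x →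
        ∀ v ∈ tangentPlane B x, ∀ w ∈ tangentPlane B x,
          wedge (fderiv ℝ (fieldStrength B) x) dj v w =
            melnikov B U σ x * fluxForm B x v w := fun dj hdj v hv w hw => by
      rw [← hw₀ v hv w hw]
      unfold wedge
      rw [hasFDerivWithinAt_unique_tangentPlane hU hB hB0 hx hdj hdj₀ hv,
        hasFDerivWithinAt_unique_tangentPlane hU hB hB0 hx hdj hdj₀ hw]
    refine ⟨hs, ha, hR.congr_uIoo ?_, fun η hη => (hR.const_mul η).congr_uIoo ?_, hsplit,
      hdj₀.differentiableWithinAt, hwedge, ?_⟩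
    · rw [huI]; exact eqOn_melnikovIntegrand hU hB hB0 hs
    · rw [huI]; exact eqOn_shiftIntegrand hU hB hB0 hσ hx hs hη
    · constructor
      · intro h
        refine ⟨dj₀, hdj₀, (not_linearIndependent_iff_wedge _ _ _).2 fun v hv w hw => ?_⟩
        have hM : melnikov B U σ x = 0 := by linarith
        rw [hw₀ v hv w hw, hM, zero_mul]
      · rintro ⟨dj, hdj, hdep⟩
        obtain ⟨v, hv, w, hw, hβ⟩ := exists_fluxForm_ne_zero hB0 hx
        have h0 := (not_linearIndependent_iff_wedge _ _ _).1 hdep v hv w hw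
        rw [hwedge dj hdj v hv w hw] at h0
        rw [hsplit, (mul_eq_zero.1 h0).resolve_right hβ, mul_zero]
  refine ⟨main, fun h => ⟨fun σ hσ x hx => ?_, (constOnEdge_iff B U).1 h.constOnEdge⟩,
    fun h => ⟨fun σ hσ x hx => ?_, (constOnEdge_iff B U).2 h.constOnEdge⟩⟩
  · exact (main σ hσ x hx).2.2.2.2.2.2.2.1 (h.noSplitting σ hσ x hx)
  · exact (main σ hσ x hx).2.2.2.2.2.2.2.2 (h.dependent σ hσ x hx)
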